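/- Let $F:\mathbb{C}^2\to\mathbb{C}^2$ be a holomorphic automorphism, fixing the origin and tangent to the identity there, such that near the origin $$F(z,w)=\bigl(z+z^2+O(z^3,z^2w),\; w-zw^2+O(z^4,z^3w,z^2w^2,zw^3)\bigr).$$ (a) The vector $(0,1)$ is a degenerate characteristic direction of $F$: if $F=\mathrm{id}+P_k+P_{k+1}+\cdots$ is the expansion at $0$ into homogeneous polynomial maps, with $k\ge 2$ and $P_k\not\equiv 0$, then $P_k(0,1)=0$. (b) For $\varepsilon>0$ and $0<\alpha<\pi/2$ put $V_{\varepsilon}^{\alpha}=\{z\in\mathbb{C}: 0<|z|<\varepsilon,\ |\mathrm{Arg}(z)-\pi|<\alpha\}$ (with $\mathrm{Arg}$ valued in $[0,2\pi)$) and $V_\varepsilon=V_\varepsilon^{\pi/8}$. There are $r>0$ and a function $\gamma$ with $\gamma(0)=0$ such that for every $0<\varepsilon\le r$: $\gamma$ is analytic on $V_\varepsilon$ and continuous on $\overline{V_\varepsilon}$; its graph $\mathcal{C}_\varepsilon=\{(z,\gamma(z)):z\in V_\varepsilon\}$ satisfies $F(\mathcal{C}_\varepsilon)\subset\mathcal{C}_\varepsilon$;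 for every $p\in\mathcal{C}_\varepsilon$, $F^n(p)\to 0$ and $[F^n(p)]\to[(1,0)]$ in $\mathbb{P}^1$; and there are constants $C_1,C_2$ with $|\gamma(z)|\le C_1|z|^3$ and $|\gamma'(z)|\le C_2|z|^2$ on $V_\varepsilon$. Moreover, for all $\alpha,\theta$ with $0<\alpha\le\pi/8$ and $\alpha\le\theta<3\pi/8$ there is $\varepsilon_0\in(0,r]$ such that for every $0<\varepsilon\le\varepsilon_0$ the set $$D_\varepsilon^{\alpha,\theta}=\{(z,w)\in\mathbb{C}^2:\ z\in V_\varepsilon^{\alpha},\ w-\gamma(z)\in V_\varepsilon^{\theta},\ |z|<|w-\gamma(z)|\}$$ is a (nonempty, open, connected) domain with the following properties. (i) If $\alpha<\theta$, then $F(D_\varepsilon^{\alpha,\theta})\subset D_\varepsilon^{\alpha,\theta}$. (ii) For every $\alpha\le\theta$ as above (in particular for $\alpha=\theta=\pi/8$) and every $p\in D_\varepsilon^{\alpha,\theta}$, writing $F^n(p)=(z_n,w_n)$: one has $F^n(p)\in D_\varepsilon^{\alpha,\theta}$ for all sufficiently large $n$, $$|z_n|\sim\frac1n,\qquad |w_n|\sim\frac1{\log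 n}\qquad(n\to\infty),$$ where $a_n\sim b_n$ means $a_n/b_n\to 1$; and $F^n(p)\to 0$ along $(0,1)$, that is, $F^n(p)\to0$ and $[F^n(p)]\to[(0,1)]$ in $\mathbb{P}^1$. -/

import Mathlib

open Filter Topology Asymptotics

namespace TangentId

/-- A holomorphic automorphism of `ℂ²`: a biholomorphic map of `ℂ²` onto itself. -/
def IsAutomorphism (F : ℂ × ℂ → ℂ × ℂ) : Prop :=
  Differentiable ℂ F ∧ ∃ G : ℂ × ℂ → ℂ × ℂ, Differentiable ℂ G ∧
    Function.LeftInverse G F ∧ Function.RightInverse G F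

/-- `F` fixes the origin and its derivative there is the identity. -/
def IsTangentToId (F : ℂ × ℂ → ℂ × ℂ) : Prop :=
  F 0 = 0 ∧ HasFDerivAt F (ContinuousLinearMap.id ℂ (ℂ × ℂ)) 0

/-- The shape
`F(z,w) = (z + z² + O(z³, z²w), w - zw² + O(z⁴, z³w, z²w², zw³))` near the origin. -/
def HasSpecialForm (F : ℂ × ℂ → ℂ × ℂ) : Prop :=
  ((fun p : ℂ × ℂ => (F p).1 - (p.1 + p.1 ^ 2)) =O[𝓝 0]
    fun p : ℂ × ℂ => ‖p.1‖ ^ 3 + ‖p.1‖ ^ 2 * ‖p.2‖) ∧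
  ((fun p : ℂ × ℂ => (F p).2 - (p.2 - p.1 * p.2 ^ 2)) =O[𝓝 0]
    fun p : ℂ × ℂ => ‖p.1‖ ^ 4 + ‖p.1‖ ^ 3 * ‖p.2‖ + ‖p.1‖ ^ 2 * ‖p.2‖ ^ 2 + ‖p.1‖ * ‖p.2‖ ^ 3)

/-- The homogeneous polynomial map `P_k` of degree `k` in the expansion
`F = P_0 + P_1 + P_2 + ...` at the origin. -/
noncomputable def homogPart (F : ℂ × ℂ → ℂ × ℂ) (k : ℕ) (v : ℂ × ℂ) : ℂ × ℂ :=
  ((k.factorial : ℂ)⁻¹) • iteratedFDeriv ℂ k F 0 (fun _ => v)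

/-- For `F = id + P_k + P_{k+1} + ...` with `k ≥ 2` and `P_k ≢ 0`, the order of `F` is `k`. -/
def HasOrder (F : ℂ × ℂ → ℂ × ℂ) (k : ℕ) : Prop :=
  2 ≤ k ∧ (∀ j, 2 ≤ j → j < k → ∀ v, homogPart F j v = 0) ∧ ∃ v, homogPart F k v ≠ 0

/-- `v ≠ 0` represents a characteristic direction with factor `c`:
`P_k(v) = c v`, where `k` is the order of `F`. -/
def IsCharacteristicDirection (F : ℂ × ℂ → ℂ × ℂ) (v : ℂ × ℂ) (c : ℂ) : Prop :=
  v ≠ 0 ∧ ∃ k, HasOrder F k ∧ homogPart F k v = c • v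

/-- A characteristic direction is degenerate if its factor is zero. -/
def IsDegenerateDirection (F : ℂ × ℂ → ℂ × ℂ) (v : ℂ × ℂ) : Prop :=
  IsCharacteristicDirection F v 0

/-- The orbit of `p` converges to the origin along the direction `v ≠ 0`: `Fⁿ(p) → 0`, the points
`Fⁿ(p)` are not the origin for large `n`, and `[Fⁿ(p)] → [v]` in the projective line, that is,
suitable representatives of the classes `[Fⁿ(p)]` converge to `v`. -/
def AttractedAlong (F : ℂ × ℂ → ℂ × ℂ) (v p : ℂ × ℂ) : Prop :=
  Tendsto (fun n : ℕ => F^[n] p) atTop (𝓝 0) ∧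
  (∀ᶠ n : ℕ in atTop, F^[n] p ≠ 0) ∧
  ∃ c : ℕ → ℂ, Tendsto (fun n : ℕ => c n • F^[n] p) atTop (𝓝 v)

/-- The sector `{z : 0 < |z| < ε, |Arg z - π| < α}` around the negative real axis
(`Arg` with values in `[0, 2π)`); `Arg z - π` is the principal argument of `-z`. -/
def sector (ε α : ℝ) : Set ℂ :=
  {z | 0 < ‖z‖ ∧ ‖z‖ < ε ∧ |Complex.arg (-z)| < α}

/-- `V_ε`, the sector of half-opening `π/8`. -/
noncomputable def V (ε : ℝ) : Set ℂ := sector ε (Real.pi / 8)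

/-- The graph of `γ` over `V_ε` is a parabolic curve of `F` attracted to the origin along `(1,0)`,
with `γ(z) = O(z³)` and derivative `O(z²)`. -/
structure IsParabolicGraph (F : ℂ × ℂ → ℂ × ℂ) (γ : ℂ → ℂ) (ε : ℝ) : Prop where
  analytic : AnalyticOnNhd ℂ γ (V ε)
  continuousOn_closure : ContinuousOn γ (closure (V ε))
  map_zero : γ 0 = 0
  invariant : ∀ z ∈ V ε, ∃ z' ∈ V ε, F (z, γ z) = (z', γ z')
  attracted : ∀ z ∈ V ε, AttractedAlong F (1, 0) (z, γ z)
  size : ∃ C : ℝ, ∀ z ∈ V ε, ‖γ z‖ ≤ C * ‖z‖ ^ 3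
  size_deriv : ∃ C : ℝ, ∀ z ∈ V ε, ‖deriv γ z‖ ≤ C * ‖z‖ ^ 2

/-- The region of all `(z, w)` with `z` in the sector of half-opening `α`, `w - γ(z)` in the sector
of half-opening `θ` (both of radius `ε`) and `|z| < |w - γ(z)|`. -/
def region (γ : ℂ → ℂ) (ε α θ : ℝ) : Set (ℂ × ℂ) :=
  {p | p.1 ∈ sector ε α ∧ p.2 - γ p.1 ∈ sector ε θ ∧ ‖p.1‖ < ‖p.2 - γ p.1‖}

end TangentId

/-! For (a), F agrees to second order with (z + z², w), so P₂ = (z², 0), which is not identically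
zero and kills (0, 1).

For the rest, put u = -1/z. The first component becomes u ↦ u + 1 + O(|u|⁻¹ + |w|) and the second w
↦ w + w²/u + O(|u|⁻¹(|u|⁻¹ + |w|)³); these estimates are `HasBounds`. Far out in a right half-plane
the map is nearly the unit translation.

The curve is found by a Perron argument. An orbit over u whose second component tends to 0 must
satisfy u_n = u + n + ∑_{k<n} drift and w_n = -∑_{k≥n} shear. On sequences with Re u_n ≥ Re u + n/2
and |w_n| ≤ 1/(Re u + n/2), the right-hand side halves a weighted distance (`near_perron`), so there
is exactly one solution. Let ψ(u) be its w-component at time 0. It is a uniform limit of holomorphic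
Picard iterates, and the orbit shifted by one step solves the problem over the next base point, so
uniqueness gives invariance (`exists_invariant_curve`). Feeding the decay back into the sum improves
it to ψ = O((Re u)⁻³), and γ(z) = ψ(-1/z).

Off the curve, put v = -1/(w - ψ(u)). Subtracting the invariance equation makes the remainder small
enough that F reads (u, v) ↦ (u + 1 + O(1/v), v + (1 + O(1/v))/u) when |u| > |v| is large
(`IsInvariantCurve.exists_step`). The region becomes |arg u| < α, |arg v| < θ, 1/ε < |v| < |u|. Here
1/u has argument less than α < θ, so v stays in its cone; α + θ < π/2 makes |v| increase; and |u|
gains at least 1/4 while |v| gains less (`IsInvariantCurve.exists_chartStep`). Re v grows at least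
like a harmonic sum, so the errors tend to 0, whence u_n/n → 1 and v_n/log n → 1 (`exists_orbit`).
Returning to (z, w) gives the asymptotics and the direction (0, 1). When α = θ, the region is placed
inside one with larger θ; since v_n/log n → 1, its orbits eventually return to the original one. -/

namespace TangentId

/-! ### The second-order part of F and the degenerate direction -/

/-- The special form as explicit bounds on a neighbourhood of the origin. -/
theorem HasSpecialForm.exists_bounds {F : ℂ × ℂ → ℂ × ℂ} (h : HasSpecialForm F) :
    ∃ C ρ : ℝ, 0 < C ∧ 0 < ρ ∧ ∀ z w : ℂ, ‖z‖ < ρ → ‖w‖ < ρ →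
      ‖(F (z, w)).1 - (z + z ^ 2)‖ ≤ C * (‖z‖ ^ 2 * (‖z‖ + ‖w‖)) ∧
      ‖(F (z, w)).2 - (w - z * w ^ 2)‖ ≤ C * (‖z‖ * (‖z‖ + ‖w‖) ^ 3) := by
  obtain ⟨h1, h2⟩ := h
  obtain ⟨C1, hC1, h1⟩ := h1.exists_pos
  obtain ⟨C2, hC2, h2⟩ := h2.exists_pos
  rw [isBigOWith_iff] at h1 h2
  obtain ⟨ρ, hρ, hb⟩ := Metric.eventually_nhds_iff.1 (h1.and h2)
  refine ⟨max C1 C2, ρ, lt_max_of_lt_left hC1, hρ, fun z w hz hw => ?_⟩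
  have := @hb (z, w) (by simp [hz, hw])
  obtain ⟨ha, hb⟩ := this
  have hz0 := norm_nonneg z
  have hw0 := norm_nonneg w
  constructor
  · refine ha.trans ?_
    simp only
    rw [Real.norm_of_nonneg (by positivity)]
    refine mul_le_mul (le_max_left _ _) (le_of_eq (by ring)) (by positivity) (by positivity)
  · refine hb.trans ?_
    simp only
    rw [Real.norm_of_nonneg (by positivity)]
    refine mul_le_mul (le_max_right _ _) ?_ (by positivity) (by positivity)
    have e : ‖z‖ * (‖z‖ + ‖w‖) ^ 3 = (‖z‖ ^ 4 + ‖z‖ ^ 3 * ‖w‖ + ‖z‖ ^ 2 * ‖w‖ ^ 2 + ‖z‖ * ‖w‖ ^ 3)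
      + (2 * (‖z‖ ^ 3 * ‖w‖) + 2 * (‖z‖ ^ 2 * ‖w‖ ^ 2)) := by ring
    rw [e]
    exact le_add_of_nonneg_right (by positivity)

/-- A holomorphic map vanishing to third order at the origin has a derivative that vanishes to
second order, so that its second derivative at the origin is zero. -/
theorem hasFDerivAt_fderiv_zero_of_isBigO {E G : Type*} [NormedAddCommGroup E] [NormedSpace ℂ E]
    [NormedAddCommGroup G] [NormedSpace ℂ G] {f : E → G} (hf : Differentiable ℂ f) {C ρ : ℝ}
    (hρ : 0 < ρ) (hC : 0 ≤ C) (hb : ∀ p, ‖p‖ < ρ → ‖f p‖ ≤ C * ‖p‖ ^ 3) :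
    HasFDerivAt (fderiv ℂ f) (0 : E →L[ℂ] E →L[ℂ] G) 0 := by
  have key : ∀ p : E, p ≠ 0 → ‖p‖ < ρ / 2 → ‖fderiv ℂ f p‖ ≤ 8 * C * ‖p‖ ^ 2 := by
    intro p hp0 hp
    have hp' : 0 < ‖p‖ := norm_pos_iff.2 hp0
    refine ContinuousLinearMap.opNorm_le_bound _ (by positivity) fun v => ?_
    rcases eq_or_ne v 0 with rfl | hv
    · simp
    have hv' : 0 < ‖v‖ := norm_pos_iff.2 hv
    have hd : HasDerivAt (fun t : ℂ => f (p + t • v)) (fderiv ℂ f p v) 0 := by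
      have h1 : HasFDerivAt f (fderiv ℂ f p) (p + (0 : ℂ) • v) := by
        simpa using (hf p).hasFDerivAt
      have h2 : HasDerivAt (fun t : ℂ => p + t • v) v 0 := by
        simpa using ((hasDerivAt_id (0 : ℂ)).smul_const v).const_add p
      exact h1.comp_hasDerivAt 0 h2
    have hdiff : Differentiable ℂ (fun t : ℂ => f (p + t • v)) :=
      hf.comp ((differentiable_const p).add (differentiable_id.smul_const v))
    -- Cauchy's estimate on the complex line p + t v: for |t| = ‖p‖/‖v‖ the points have norm at most
    -- 2‖p‖ < ρ, whence the factor 2³ = 8.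
    have := Complex.norm_deriv_le_of_forall_mem_sphere_norm_le (c := (0 : ℂ)) (R := ‖p‖ / ‖v‖)
      (C := C * (2 * ‖p‖) ^ 3) (by positivity) hdiff.diffContOnCl (fun t ht => by
        have ht' : ‖t‖ = ‖p‖ / ‖v‖ := by simpa using ht
        have hn : ‖p + t • v‖ ≤ 2 * ‖p‖ := by
          refine (norm_add_le _ _).trans ?_
          rw [norm_smul, ht', div_mul_cancel₀ _ hv'.ne']
          linarith
        refine (hb _ (by linarith)).trans ?_
        gcongr)
    rw [hd.deriv] at this
    refine this.trans (le_of_eq ?_)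
    field_simp
    ring
  have h0 : fderiv ℂ f 0 = 0 := by
    have : HasFDerivAt f (0 : E →L[ℂ] G) 0 := by
      rw [hasFDerivAt_iff_isLittleO_nhds_zero]
      have hf0 : f 0 = 0 := by simpa using hb 0 (by simpa using hρ)
      simp only [zero_add, hf0, sub_zero, zero_apply]
      refine (IsBigO.of_bound C ?_).trans_isLittleO
        (isLittleO_norm_pow_id (n := 3) (by norm_num))
      filter_upwards [Metric.ball_mem_nhds (0 : E) hρ] with p hp
      simpa using hb p (by simpa using hp)
    exact this.fderiv
  rw [hasFDerivAt_iff_isLittleO_nhds_zero]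
  simp only [zero_add, h0, sub_zero, zero_apply]
  refine (IsBigO.of_bound (8 * C) ?_).trans_isLittleO (isLittleO_norm_pow_id (n := 2) (by norm_num))
  filter_upwards [Metric.ball_mem_nhds (0 : E) (half_pos hρ)] with p hp
  rcases eq_or_ne p 0 with rfl | hp0
  · simp [h0]
  simpa using key p hp0 (by simpa using hp)

/-- F minus (z + z², w) is of third order, because -zw² is itself cubic. Its second derivative at 0
vanishes, so the quadratic part can be read off the polynomial. -/
theorem homogPart_two {F : ℂ × ℂ → ℂ × ℂ} (hF : Differentiable ℂ F) (hform : HasSpecialForm F)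
    (v : ℂ × ℂ) : homogPart F 2 v = (v.1 ^ 2, 0) := by
  obtain ⟨C, ρ, hC, hρ, hb⟩ := hform.exists_bounds
  set E : ℂ × ℂ → ℂ × ℂ := fun p => F p - (p.1 + p.1 ^ 2, p.2) with hE
  have hQ : ∀ p : ℂ × ℂ, HasFDerivAt (fun p : ℂ × ℂ => (p.1 + p.1 ^ 2, p.2))
      (ContinuousLinearMap.id ℂ (ℂ × ℂ) + (((2 : ℂ) * p.1) • ContinuousLinearMap.fst ℂ ℂ ℂ).prod 0)
      p := by
    intro p
    have h1 : HasFDerivAt (fun p : ℂ × ℂ => p.1) (ContinuousLinearMap.fst ℂ ℂ ℂ) p := hasFDerivAt_fst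
    have h2 : HasFDerivAt (fun p : ℂ × ℂ => p.2) (ContinuousLinearMap.snd ℂ ℂ ℂ) p := hasFDerivAt_snd
    refine ((h1.add (h1.pow 2)).prodMk h2).congr_fderiv ?_
    ext <;> simp
  have hEd : Differentiable ℂ E := hF.sub fun p => (hQ p).differentiableAt
  have hE3 : ∀ p, ‖p‖ < min ρ 1 → ‖E p‖ ≤ (8 * C + 1) * ‖p‖ ^ 3 := by
    rintro ⟨z, w⟩ hp
    have hz : ‖z‖ ≤ ‖(z, w)‖ := norm_fst_le (z, w)
    have hw : ‖w‖ ≤ ‖(z, w)‖ := norm_snd_le (z, w)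
    set N := ‖(z, w)‖
    have hz0 := norm_nonneg z
    have hw0 := norm_nonneg w
    have hN1 : N < 1 := hp.trans_le (min_le_right _ _)
    have hNρ : N < ρ := hp.trans_le (min_le_left _ _)
    have hN0 : 0 ≤ N := hz0.trans hz
    obtain ⟨h1, h2⟩ := hb z w (hz.trans_lt hNρ) (hw.trans_lt hNρ)
    have e3 : 0 ≤ C * N ^ 3 := by positivity
    have e3' : 0 ≤ N ^ 3 := by positivity
    rw [Prod.norm_def]
    refine max_le ?_ ?_
    · refine h1.trans ?_
      have : C * (‖z‖ ^ 2 * (‖z‖ + ‖w‖)) ≤ C * (N ^ 2 * (N + N)) := by gcongr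
      nlinarith
    · have e : (E (z, w)).2 = ((F (z, w)).2 - (w - z * w ^ 2)) + - (z * w ^ 2) := by
        simp [hE]
        ring
      rw [e]
      refine (norm_add_le _ _).trans ?_
      rw [norm_neg, norm_mul, norm_pow]
      have a : C * (‖z‖ * (‖z‖ + ‖w‖) ^ 3) ≤ C * (N * (N + N) ^ 3) := by gcongr
      have b : ‖z‖ * ‖w‖ ^ 2 ≤ N * N ^ 2 := by gcongr
      have c : C * (N * (N + N) ^ 3) ≤ 8 * (C * N ^ 3) := by
        have : C * (N * (N + N) ^ 3) = 8 * (C * N ^ 3) * N := by ring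
        rw [this]
        exact mul_le_of_le_one_right (by positivity) hN1.le
      linarith [h2, pow_succ' N 2]
  have hE' := hasFDerivAt_fderiv_zero_of_isBigO hEd (lt_min hρ one_pos) (by positivity) hE3
  let Λ : (ℂ × ℂ) →L[ℂ] (ℂ × ℂ) →L[ℂ] (ℂ × ℂ) :=
    (ContinuousLinearMap.fst ℂ ℂ ℂ).smulRight
      (((2 : ℂ) • ContinuousLinearMap.fst ℂ ℂ ℂ).prod (0 : ℂ × ℂ →L[ℂ] ℂ))
  have hfd : fderiv ℂ F = fun p => (fderiv ℂ E p + ContinuousLinearMap.id ℂ (ℂ × ℂ)) + Λ p := by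
    funext p
    have h1 : F = E + fun p => (p.1 + p.1 ^ 2, p.2) := funext fun p => by simp [hE]
    have h2 := ((hEd p).hasFDerivAt.add (hQ p)).fderiv
    rw [← h1] at h2
    rw [h2, add_assoc]
    congr 2
    refine ContinuousLinearMap.ext fun q => ?_
    simp [Λ]
    ring
  have hfin : HasFDerivAt (fderiv ℂ F) Λ 0 := by
    rw [hfd]
    exact ((hE'.add_const (ContinuousLinearMap.id ℂ (ℂ × ℂ))).add Λ.hasFDerivAt).congr_fderiv
      (zero_add Λ)
  rw [homogPart, iteratedFDeriv_two_apply, hfin.fderiv]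
  simp [Λ]
  ring

theorem isDegenerateDirection_zero_one {F : ℂ × ℂ → ℂ × ℂ} (hF : Differentiable ℂ F)
    (hform : HasSpecialForm F) : IsDegenerateDirection F (0, 1) := by
  refine ⟨by simp, 2, ⟨le_rfl, fun j h1 h2 => by omega, (1, 0), ?_⟩, ?_⟩
  · simp [homogPart_two hF hform]
  · simp [homogPart_two hF hform]

/-! ### The map in the coordinate u = -1/z -/

/-- In the coordinate `u = -1/z`, the first component of `F` reads `u ↦ u + 1 + drift F (u, w)`. -/
noncomputable def drift (F : ℂ × ℂ → ℂ × ℂ) (p : ℂ × ℂ) : ℂ :=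
  -((F (-p.1⁻¹, p.2)).1)⁻¹ - p.1 - 1

/-- In the coordinate `u = -1/z`, the second component of `F` reads `w ↦ w + shear F (u, w)`. -/
noncomputable def shear (F : ℂ × ℂ → ℂ × ℂ) (p : ℂ × ℂ) : ℂ :=
  (F (-p.1⁻¹, p.2)).2 - p.2

/-- The estimates on `F` near the origin, in the coordinate `u = -1/z`. -/
structure HasBounds (F : ℂ × ℂ → ℂ × ℂ) (K R : ℝ) : Prop where
  one_le_K : 1 ≤ K
  le_R : 1000 * K ≤ R
  ne_zero : ∀ u w : ℂ, R ≤ ‖u‖ → ‖w‖ ≤ 1 / R → (F (-u⁻¹, w)).1 ≠ 0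
  drift_le : ∀ u w : ℂ, R ≤ ‖u‖ → ‖w‖ ≤ 1 / R → ‖drift F (u, w)‖ ≤ K * (‖u‖⁻¹ + ‖w‖)
  shear_le : ∀ u w : ℂ, R ≤ ‖u‖ → ‖w‖ ≤ 1 / R →
    ‖shear F (u, w) - w ^ 2 / u‖ ≤ K * (‖u‖⁻¹ * (‖u‖⁻¹ + ‖w‖) ^ 3)

/-- If `f = z + z² + e z²` with `z`, `e` small, then `-1/f = -1/z + 1 + O(|z| + |e|)`. -/
theorem norm_neg_inv_sub_le {z f : ℂ} {d : ℝ} (hz : z ≠ 0) (hz8 : ‖z‖ ≤ 1 / 8) (hd : d ≤ 1)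
    (hf : ‖f - (z + z ^ 2)‖ ≤ d * ‖z‖ ^ 2) :
    f ≠ 0 ∧ ‖-f⁻¹ + z⁻¹ - 1‖ ≤ 4 * (‖z‖ + d) := by
  have hz0 : 0 < ‖z‖ := norm_pos_iff.2 hz
  set e : ℂ := (f - (z + z ^ 2)) / z ^ 2 with he
  have hfe : f = z * (1 + z * (1 + e)) := by rw [he]; field_simp; ring
  have hen : ‖e‖ ≤ d := by
    rw [he, norm_div, norm_pow]
    exact (div_le_iff₀ (by positivity)).2 hf
  have he1 : ‖1 + e‖ ≤ 2 := by
    refine (norm_add_le _ _).trans ?_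
    rw [norm_one]; linarith
  have hq : ‖z * (1 + e)‖ ≤ 2 * ‖z‖ := by
    rw [norm_mul]; nlinarith
  have hq1 : 1 / 2 ≤ ‖1 + z * (1 + e)‖ := by
    have := norm_sub_le (1 + z * (1 + e)) (z * (1 + e))
    rw [add_sub_cancel_right, norm_one] at this
    linarith
  have hne : 1 + z * (1 + e) ≠ 0 := by
    intro h; rw [h, norm_zero] at hq1; linarith
  have hf0 : f ≠ 0 := by rw [hfe]; exact mul_ne_zero hz hne
  refine ⟨hf0, ?_⟩
  have key : -f⁻¹ + z⁻¹ - 1 = (e - z * (1 + e)) / (1 + z * (1 + e)) := by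
    rw [hfe]; field_simp; ring
  rw [key, norm_div, div_le_iff₀ (by linarith)]
  have h1 : ‖e - z * (1 + e)‖ ≤ d + 2 * ‖z‖ := (norm_sub_le _ _).trans (by linarith)
  have h2 : 0 ≤ d := (norm_nonneg _).trans hen
  nlinarith

/-- The choice R ≥ 2/ρ keeps all points in the neighbourhood where the original bounds hold, and R ≥
1000K makes every error term of the form K/R negligible. -/
theorem HasSpecialForm.exists_hasBounds {F : ℂ × ℂ → ℂ × ℂ} (h : HasSpecialForm F) :
    ∃ K R : ℝ, HasBounds F K R := by
  obtain ⟨C, ρ, hC, hρ, hb⟩ := h.exists_bounds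
  set K : ℝ := 4 * (1 + C) + 1 with hK
  set R : ℝ := max (2 / ρ) (1000 * K) with hR
  have hK1 : 1 ≤ K := by linarith
  have hRK : 1000 * K ≤ R := le_max_right _ _
  have hRρ : 2 / ρ ≤ R := le_max_left _ _
  have hR0 : 0 < R := by linarith
  have hsmall : 1 / R < ρ := by
    rw [div_le_iff₀ hρ] at hRρ
    rw [div_lt_iff₀ hR0]; nlinarith
  have main : ∀ u w : ℂ, R ≤ ‖u‖ → ‖w‖ ≤ 1 / R → (F (-u⁻¹, w)).1 ≠ 0 ∧
      ‖drift F (u, w)‖ ≤ K * (‖u‖⁻¹ + ‖w‖) ∧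
      ‖shear F (u, w) - w ^ 2 / u‖ ≤ K * (‖u‖⁻¹ * (‖u‖⁻¹ + ‖w‖) ^ 3) := by
    intro u w hu hw
    have hu0 : 0 < ‖u‖ := hR0.trans_le hu
    have hu0' : u ≠ 0 := norm_pos_iff.1 hu0
    have hz : ‖-u⁻¹‖ = ‖u‖⁻¹ := by rw [norm_neg, norm_inv]
    have hzR : ‖u‖⁻¹ ≤ 1 / R := by rw [one_div]; exact inv_anti₀ hR0 hu
    have hR1 : 1 / R ≤ 1 / (1000 * K) := one_div_le_one_div_of_le (by positivity) hRK
    have hR2 : 1 / (1000 * K) * K = 1 / 1000 := by field_simp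
    have hw0 := norm_nonneg w
    have hz0 : 0 ≤ ‖u‖⁻¹ := by positivity
    obtain ⟨h1, h2⟩ := hb (-u⁻¹) w (by rw [hz]; linarith) (by linarith)
    rw [hz] at h1 h2
    have hz8 : 1 / (1000 * K) ≤ 1 / 8 := one_div_le_one_div_of_le (by norm_num) (by linarith)
    obtain ⟨ha, hb'⟩ := norm_neg_inv_sub_le (z := -u⁻¹) (f := (F (-u⁻¹, w)).1)
      (d := C * (‖u‖⁻¹ + ‖w‖)) (neg_ne_zero.2 (inv_ne_zero hu0')) (by rw [hz]; linarith)
      (by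
        have : C * (‖u‖⁻¹ + ‖w‖) ≤ K * (1 / (1000 * K) + 1 / (1000 * K)) := by
          refine mul_le_mul (by linarith) (by linarith) (by positivity) (by positivity)
        linarith)
      (by rw [hz]; refine h1.trans (le_of_eq (by ring)))
    refine ⟨ha, ?_, ?_⟩
    · have e : drift F (u, w) = -(F (-u⁻¹, w)).1⁻¹ + (-u⁻¹)⁻¹ - 1 := by
        simp only [drift, inv_neg, inv_inv]; ring
      rw [e]
      refine hb'.trans ?_
      rw [hz]
      nlinarith
    · have e : shear F (u, w) - w ^ 2 / u = (F (-u⁻¹, w)).2 - (w - -u⁻¹ * w ^ 2) := by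
        simp only [shear]; field_simp; ring
      rw [e]
      refine h2.trans ?_
      gcongr
      linarith
  exact ⟨K, R, hK1, hRK, fun u w hu hw => (main u w hu hw).1,
    fun u w hu hw => (main u w hu hw).2.1, fun u w hu hw => (main u w hu hw).2.2⟩

namespace HasBounds
variable {F : ℂ × ℂ → ℂ × ℂ} {K R : ℝ}

theorem R_pos (h : HasBounds F K R) : 0 < R := by
  have := h.one_le_K; have := h.le_R; linarith

theorem ne_zero_of_le (h : HasBounds F K R) {u : ℂ} (hu : R ≤ ‖u‖) : u ≠ 0 :=
  norm_pos_iff.1 (h.R_pos.trans_le hu)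

theorem differentiableAt_drift (h : HasBounds F K R) (hF : Differentiable ℂ F) {p : ℂ × ℂ}
    (hu : R ≤ ‖p.1‖) (hw : ‖p.2‖ ≤ 1 / R) : DifferentiableAt ℂ (drift F) p := by
  have h1 : DifferentiableAt ℂ (fun p : ℂ × ℂ => (-p.1⁻¹, p.2)) p :=
    (differentiableAt_fst.inv (h.ne_zero_of_le hu)).neg.prodMk differentiableAt_snd
  have h2 : DifferentiableAt ℂ (fun p : ℂ × ℂ => (F (-p.1⁻¹, p.2)).1) p :=
    (DifferentiableAt.comp p (hF _) h1).fst
  exact ((h2.inv (h.ne_zero _ _ hu hw)).neg.sub differentiableAt_fst).sub_const 1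

theorem differentiableAt_shear (h : HasBounds F K R) (hF : Differentiable ℂ F) {p : ℂ × ℂ}
    (hu : R ≤ ‖p.1‖) : DifferentiableAt ℂ (shear F) p := by
  have h1 : DifferentiableAt ℂ (fun p : ℂ × ℂ => (-p.1⁻¹, p.2)) p :=
    (differentiableAt_fst.inv (h.ne_zero_of_le hu)).neg.prodMk differentiableAt_snd
  have h2 : DifferentiableAt ℂ (fun p : ℂ × ℂ => (F (-p.1⁻¹, p.2)).2) p :=
    (DifferentiableAt.comp p (hF _) h1).snd
  exact h2.sub differentiableAt_snd

/-- `F` in the coordinate `u = -1/z`. -/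
theorem apply_eq (h : HasBounds F K R) {u w : ℂ} (hu : R ≤ ‖u‖) (hw : ‖w‖ ≤ 1 / R) :
    F (-u⁻¹, w) = (-(u + 1 + drift F (u, w))⁻¹, w + shear F (u, w)) := by
  have := h.ne_zero u w hu hw
  ext
  · simp [drift]
  · simp [shear]

/-- The leading term w²/u is absorbed into the error. This crude form suffices while w is comparable
to 1/u: the shear is then cubic in 1/u, hence summable along orbits. -/
theorem norm_shear_le (h : HasBounds F K R) {u w : ℂ} (hu : R ≤ ‖u‖) (hw : ‖w‖ ≤ 1 / R) :
    ‖shear F (u, w)‖ ≤ 2 * K * (‖u‖⁻¹ * (‖u‖⁻¹ + ‖w‖) ^ 2) := by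
  have h1 := h.shear_le u w hu hw
  have hR := h.R_pos
  have hK := h.one_le_K
  have hu0 : 0 < ‖u‖ := hR.trans_le hu
  have hzR : ‖u‖⁻¹ ≤ 1 / R := by rw [one_div]; exact inv_anti₀ hR hu
  have hw0 := norm_nonneg w
  have hz0 : 0 ≤ ‖u‖⁻¹ := by positivity
  have hR2 : 1 / R ≤ 1 / 2 :=
    one_div_le_one_div_of_le (by norm_num) (by have := h.le_R; linarith)
  have hs1 : ‖u‖⁻¹ + ‖w‖ ≤ 1 := by linarith
  have e : shear F (u, w) = (shear F (u, w) - w ^ 2 / u) + w ^ 2 / u := by ring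
  rw [e]
  refine (norm_add_le _ _).trans ?_
  have h2 : ‖w ^ 2 / u‖ ≤ ‖u‖⁻¹ * (‖u‖⁻¹ + ‖w‖) ^ 2 := by
    rw [norm_div, norm_pow, div_eq_inv_mul]
    gcongr
    linarith
  have h3 : ‖u‖⁻¹ * (‖u‖⁻¹ + ‖w‖) ^ 3 ≤ ‖u‖⁻¹ * (‖u‖⁻¹ + ‖w‖) ^ 2 := by
    refine mul_le_mul_of_nonneg_left ?_ hz0
    exact pow_le_pow_of_le_one (by positivity) hs1 (by norm_num)
  have h4 : 0 ≤ ‖u‖⁻¹ * (‖u‖⁻¹ + ‖w‖) ^ 2 := by positivity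
  nlinarith

end HasBounds
-- Tail sums and a scale-invariant Lipschitz estimate
-- Telescoping: 4/y - 4/(y + 1/2) = 2/(y(y + 1/2)), which is at least 1/y² as soon as y ≥ 1/2.
theorem sum_range_one_div_sq_le {x : ℝ} (hx : 1 ≤ x) (n : ℕ) :
    ∑ k ∈ Finset.range n, 1 / (x + k / 2) ^ 2 ≤ 4 / x - 4 / (x + n / 2) := by
  induction n with
  | zero => simp
  | succ n ih =>
    rw [Finset.sum_range_succ]
    have hn : (0 : ℝ) ≤ n := Nat.cast_nonneg n
    set y : ℝ := x + n / 2 with hy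
    have hy1 : 1 ≤ y := by linarith
    have e : x + ((n + 1 : ℕ) : ℝ) / 2 = y + 1 / 2 := by push_cast; ring
    rw [e]
    have h2 : 1 / y ^ 2 ≤ 4 / y - 4 / (y + 1 / 2) := by
      rw [div_sub_div _ _ (by positivity) (by positivity), div_le_div_iff₀ (by positivity)
        (by positivity)]
      nlinarith [sq_nonneg y]
    linarith

/-- Tails of series whose terms decay like `(x + k/2)^(-(j+2))`. -/
theorem summable_and_norm_tsum_le {f : ℕ → ℂ} {M x : ℝ} (j : ℕ) (hx : 1 ≤ x)
    (hf : ∀ k : ℕ, ‖f k‖ ≤ M / (x + k / 2) ^ (j + 2)) :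
    Summable (fun k : ℕ => M / (x + k / 2) ^ (j + 2)) ∧ ‖∑' k, f k‖ ≤ 4 * M / x ^ (j + 1) := by
  have hM : 0 ≤ M := by
    have := (norm_nonneg _).trans (hf 0)
    by_contra hneg
    push Not at hneg
    have : M / (x + (0 : ℕ) / 2) ^ (j + 2) < 0 := div_neg_of_neg_of_pos hneg (by simp; positivity)
    linarith
  have hx0 : 0 < x := by linarith
  have hle : ∀ k : ℕ, M / (x + k / 2) ^ (j + 2) ≤ M / x ^ j * (1 / (x + k / 2) ^ 2) := by
    intro k
    rw [pow_add, div_mul_div_comm, mul_one]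
    gcongr
    linarith [(Nat.cast_nonneg k : (0 : ℝ) ≤ k)]
  have hsum : ∀ n : ℕ, ∑ k ∈ Finset.range n, M / (x + k / 2) ^ (j + 2) ≤ 4 * M / x ^ (j + 1) := by
    intro n
    refine (Finset.sum_le_sum fun k _ => hle k).trans ?_
    rw [← Finset.mul_sum]
    have h1 := sum_range_one_div_sq_le hx n
    have h2 : 0 ≤ 4 / (x + n / 2) := by positivity
    have e : 4 * M / x ^ (j + 1) = M / x ^ j * (4 / x) := by rw [pow_succ]; field_simp
    rw [e]
    exact mul_le_mul_of_nonneg_left (by linarith) (by positivity)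
  have hpos : ∀ k : ℕ, 0 ≤ M / (x + k / 2) ^ (j + 2) := fun k => by positivity
  have hs := summable_of_sum_range_le hpos hsum
  exact ⟨hs, (tsum_of_norm_bounded hs.hasSum hf).trans (Real.tsum_le_of_sum_range_le hpos hsum)⟩

/-- Scale-invariant Lipschitz estimate for a bounded holomorphic function near
`{Re u ≥ L, |w| ≤ 1/L}`. -/
theorem norm_sub_le_of_scaled {h : ℂ × ℂ → ℂ} {L M A : ℝ} (hL : 0 < L) (hA : 0 < A)
    (hd : ∀ x : ℂ × ℂ, L / 2 ≤ ‖x.1‖ → ‖x.2‖ ≤ 2 / L → DifferentiableAt ℂ h x)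
    (hM : ∀ x : ℂ × ℂ, L / 2 ≤ ‖x.1‖ → ‖x.2‖ ≤ 2 / L → ‖h x‖ ≤ M) {p q : ℂ × ℂ}
    (hp1 : L ≤ p.1.re) (hp2 : ‖p.2‖ ≤ 1 / L) (hq1 : L ≤ q.1.re) (hq2 : ‖q.2‖ ≤ 1 / L)
    (h1 : ‖p.1 - q.1‖ ≤ A * L) (h2 : ‖p.2 - q.2‖ ≤ A / L) : ‖h p - h q‖ ≤ 2 * A * M := by
  -- Along the complexified segment from q to p, the discs of radius 1/(2A) about the points of [0,
  -- 1] stay in the enlarged domain. Cauchy's estimate gives |φ'| ≤ 2AM on [0, 1].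
  set φ : ℂ → ℂ := fun t => h (q + t • (p - q)) with hφ
  have hin : ∀ s ∈ Set.Icc (0 : ℝ) 1, ∀ t : ℂ, ‖t - s‖ ≤ 1 / (2 * A) →
      L / 2 ≤ ‖(q + t • (p - q)).1‖ ∧ ‖(q + t • (p - q)).2‖ ≤ 2 / L := by
    intro s hs t ht
    constructor
    · have e : (q + t • (p - q)).1 = (q.1 + (s : ℂ) * (p.1 - q.1)) + (t - s) * (p.1 - q.1) := by
        simp; ring
      have hre : L ≤ (q.1 + (s : ℂ) * (p.1 - q.1)).re := by
        have : (q.1 + (s : ℂ) * (p.1 - q.1)).re = (1 - s) * q.1.re + s * p.1.re := by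
          simp; ring
        rw [this]; nlinarith [hs.1, hs.2]
      have hn : L ≤ ‖q.1 + (s : ℂ) * (p.1 - q.1)‖ := hre.trans (Complex.re_le_norm _)
      have hm : ‖(t - s) * (p.1 - q.1)‖ ≤ L / 2 := by
        rw [norm_mul]
        calc _ ≤ 1 / (2 * A) * (A * L) := by gcongr
          _ = L / 2 := by field_simp
      rw [e]
      have := norm_sub_le (q.1 + (s : ℂ) * (p.1 - q.1) + (t - s) * (p.1 - q.1))
        ((t - s) * (p.1 - q.1))
      rw [add_sub_cancel_right] at this
      linarith
    · have e : (q + t • (p - q)).2 =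
          ((1 - s : ℝ) : ℂ) * q.2 + (s : ℂ) * p.2 + (t - s) * (p.2 - q.2) := by
        simp; ring
      rw [e]
      have hm : ‖(t - s) * (p.2 - q.2)‖ ≤ 1 / L := by
        rw [norm_mul]
        calc _ ≤ 1 / (2 * A) * (A / L) := by gcongr
          _ = 1 / L * (1 / 2) := by field_simp
          _ ≤ 1 / L := mul_le_of_le_one_right (by positivity) (by norm_num)
      refine (norm_add_le _ _).trans ?_
      have hc : ‖((1 - s : ℝ) : ℂ) * q.2 + (s : ℂ) * p.2‖ ≤ 1 / L := by
        refine (norm_add_le _ _).trans ?_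
        rw [norm_mul, norm_mul, Complex.norm_real, Complex.norm_real,
          Real.norm_of_nonneg (by linarith [hs.2]), Real.norm_of_nonneg hs.1]
        calc _ ≤ (1 - s) * (1 / L) + s * (1 / L) :=
              add_le_add (mul_le_mul_of_nonneg_left hq2 (by linarith [hs.2]))
                (mul_le_mul_of_nonneg_left hp2 hs.1)
          _ = 1 / L := by ring
      calc _ ≤ 1 / L + 1 / L := add_le_add hc hm
        _ = 2 / L := by ring
  have hA' : 0 < 1 / (2 * A) := by positivity
  have hdiff : ∀ s ∈ Set.Icc (0 : ℝ) 1, ∀ t : ℂ, ‖t - s‖ ≤ 1 / (2 * A) →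
      DifferentiableAt ℂ φ t := by
    intro s hs t ht
    obtain ⟨ha, hb⟩ := hin s hs t ht
    exact DifferentiableAt.comp t (hd _ ha hb)
      ((differentiableAt_id.smul_const (p - q)).const_add q)
  have hder : ∀ s ∈ Set.Icc (0 : ℝ) 1, ‖deriv φ s‖ ≤ 2 * A * M := by
    intro s hs
    have := Complex.norm_deriv_le_of_forall_mem_sphere_norm_le (c := (s : ℂ)) (f := φ) (C := M) hA'
      (DifferentiableOn.diffContOnCl fun t ht => by
        rw [closure_ball _ hA'.ne', mem_closedBall_iff_norm] at ht
        exact (hdiff s hs t ht).differentiableWithinAt)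
      (fun t ht => by
        obtain ⟨ha, hb⟩ := hin s hs t (mem_sphere_iff_norm.1 ht).le
        exact hM _ ha hb)
    refine this.trans (le_of_eq ?_)
    field_simp
  have hreal : ∀ s ∈ Set.Icc (0 : ℝ) 1,
      HasDerivWithinAt (fun s : ℝ => φ s) (deriv φ s) (Set.Icc 0 1) s := by
    intro s hs
    exact ((hdiff s hs s (by simpa using hA'.le)).hasDerivAt.comp_ofReal).hasDerivWithinAt
  have := norm_image_sub_le_of_norm_deriv_le_segment_01' hreal
    (fun s hs => hder s (Set.Ico_subset_Icc_self hs))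
  simpa [hφ] using this

/-! ### Orbits on the curve as fixed points of a contraction -/

/-- The growth scale of the `n`-th point of an orbit starting over `u`. -/
noncomputable def level (u : ℂ) (n : ℕ) : ℝ := u.re + n / 2

theorem level_add (u : ℂ) (n k : ℕ) : level u (n + k) = level u n + k / 2 := by
  simp only [level]; push_cast; ring

/-- The sequences among which the orbit on the parabolic curve is sought. -/
def Admissible (u : ℂ) (p : ℕ → ℂ × ℂ) : Prop :=
  ∀ n, ‖(p n).1 - (u + n)‖ ≤ n / 2 ∧ ‖(p n).2‖ ≤ 1 / level u n

/-- The operator whose fixed points are the orbits over `u` with vanishing second component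
at infinity. -/
noncomputable def perron (F : ℂ × ℂ → ℂ × ℂ) (u : ℂ) (p : ℕ → ℂ × ℂ) (n : ℕ) : ℂ × ℂ :=
  (u + n + ∑ k ∈ Finset.range n, drift F (p k), -∑' k, shear F (p (n + k)))

/-- Weighted distance between two sequences over `u`. -/
def Near (u : ℂ) (A : ℝ) (p q : ℕ → ℂ × ℂ) : Prop :=
  ∀ n, ‖(p n).1 - (q n).1‖ ≤ A * level u n ∧ ‖(p n).2 - (q n).2‖ ≤ A / level u n

/-- The iterates of `perron F u`, starting from the orbit of the translation `u ↦ u + 1`. -/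
noncomputable def picard (F : ℂ × ℂ → ℂ × ℂ) (u : ℂ) : ℕ → ℕ → ℂ × ℂ
  | 0 => fun n => (u + n, 0)
  | m + 1 => perron F u (picard F u m)

/-- The deviation n/2 allowed from u + n still leaves half of the unit speed to the right. -/
theorem Admissible.level_le_re {u : ℂ} {p : ℕ → ℂ × ℂ} (hp : Admissible u p) (n : ℕ) :
    level u n ≤ (p n).1.re := by
  have h1 := (Complex.abs_re_le_norm _).trans (hp n).1
  have h2 := (abs_le.1 h1).1
  simp only [Complex.sub_re, Complex.add_re, Complex.natCast_re] at h2
  simp only [level]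
  linarith

theorem Admissible.near {u : ℂ} (hu : 0 < u.re) {p q : ℕ → ℂ × ℂ} (hp : Admissible u p)
    (hq : Admissible u q) : Near u 2 p q := by
  intro n
  have hn : (0 : ℝ) ≤ n := Nat.cast_nonneg n
  constructor
  · have e : (p n).1 - (q n).1 = ((p n).1 - (u + n)) - ((q n).1 - (u + n)) := by ring
    rw [e]
    refine (norm_sub_le _ _).trans ((add_le_add (hp n).1 (hq n).1).trans ?_)
    simp only [level]; linarith
  · refine (norm_sub_le _ _).trans ((add_le_add (hp n).2 (hq n).2).trans (le_of_eq ?_))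
    ring

namespace HasBounds
variable {F : ℂ × ℂ → ℂ × ℂ} {K R : ℝ}

theorem le_level (h : HasBounds F K R) {u : ℂ} (hu : 2 * R < u.re) (n : ℕ) :
    2000 * K ≤ level u n ∧ 2 * R ≤ level u n := by
  have hn : (0 : ℝ) ≤ n := Nat.cast_nonneg n
  have := h.le_R
  simp only [level]
  constructor <;> linarith

theorem one_le_level (h : HasBounds F K R) {u : ℂ} (hu : 2 * R < u.re) (n : ℕ) :
    1 ≤ level u n := by
  have := (h.le_level hu n).1
  have := h.one_le_K
  linarith

theorem admissible_range (h : HasBounds F K R) {u : ℂ} (hu : 2 * R < u.re) {p : ℕ → ℂ × ℂ}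
    (hp : Admissible u p) (n : ℕ) :
    level u n ≤ ‖(p n).1‖ ∧ R ≤ ‖(p n).1‖ ∧ ‖(p n).2‖ ≤ 1 / R := by
  have h1 := (hp.level_le_re n).trans (Complex.re_le_norm _)
  have h2 := (h.le_level hu n).2
  have hR := h.R_pos
  refine ⟨h1, by linarith, (hp n).2.trans (one_div_le_one_div_of_le hR (by linarith))⟩

theorem norm_drift_le_of_admissible (h : HasBounds F K R) {u : ℂ} (hu : 2 * R < u.re)
    {p : ℕ → ℂ × ℂ} (hp : Admissible u p) (n : ℕ) : ‖drift F (p n)‖ ≤ 1 / 2 := by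
  obtain ⟨h1, h2, h3⟩ := h.admissible_range hu hp n
  have hL1 := h.one_le_level hu n
  have hL2 := (h.le_level hu n).1
  have hK := h.one_le_K
  refine (h.drift_le _ _ h2 h3).trans ?_
  have h4 : ‖(p n).1‖⁻¹ ≤ 1 / level u n := by
    rw [one_div]; exact inv_anti₀ (by linarith) h1
  calc K * (‖(p n).1‖⁻¹ + ‖(p n).2‖) ≤ K * (1 / level u n + 1 / level u n) := by
        gcongr; exact (hp n).2
    _ = 2 * K / level u n := by ring
    _ ≤ 1 / 2 := by rw [div_le_div_iff₀ (by linarith) (by norm_num)]; linarith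

theorem norm_shear_le_of_admissible (h : HasBounds F K R) {u : ℂ} (hu : 2 * R < u.re)
    {p : ℕ → ℂ × ℂ} (hp : Admissible u p) (n : ℕ) :
    ‖shear F (p n)‖ ≤ 8 * K / level u n ^ 3 := by
  obtain ⟨h1, h2, h3⟩ := h.admissible_range hu hp n
  have hL1 := h.one_le_level hu n
  have hK := h.one_le_K
  refine (h.norm_shear_le h2 h3).trans ?_
  have h4 : ‖(p n).1‖⁻¹ ≤ 1 / level u n := by
    rw [one_div]; exact inv_anti₀ (by linarith) h1
  calc 2 * K * (‖(p n).1‖⁻¹ * (‖(p n).1‖⁻¹ + ‖(p n).2‖) ^ 2)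
      ≤ 2 * K * (1 / level u n * (1 / level u n + 1 / level u n) ^ 2) := by
        gcongr; exact (hp n).2
    _ = 8 * K / level u n ^ 3 := by field_simp; ring

theorem summable_shear_and_norm_le (h : HasBounds F K R) {u : ℂ} (hu : 2 * R < u.re)
    {p : ℕ → ℂ × ℂ} (hp : Admissible u p) (n : ℕ) :
    Summable (fun k => shear F (p (n + k))) ∧
      ‖∑' k, shear F (p (n + k))‖ ≤ 32 * K / level u n ^ 2 := by
  have hb : ∀ k : ℕ, ‖shear F (p (n + k))‖ ≤ 8 * K / (level u n + k / 2) ^ (1 + 2) := by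
    intro k
    rw [← level_add]
    exact h.norm_shear_le_of_admissible hu hp (n + k)
  obtain ⟨ha, hb'⟩ := summable_and_norm_tsum_le 1 (h.one_le_level hu n) hb
  exact ⟨Summable.of_norm_bounded ha hb, hb'.trans (le_of_eq (by ring))⟩

/-- Each drift is at most 1/2, so n of them deviate by at most n/2; the shear tail is O(K/L²), which
is below 1/L because L ≥ 2000K. -/
theorem admissible_perron (h : HasBounds F K R) {u : ℂ} (hu : 2 * R < u.re)
    {p : ℕ → ℂ × ℂ} (hp : Admissible u p) : Admissible u (perron F u p) := by
  intro n
  have hL1 := h.one_le_level hu n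
  have hL2 := (h.le_level hu n).1
  constructor
  · simp only [perron, add_sub_cancel_left]
    refine (norm_sum_le_of_le _ fun k _ => h.norm_drift_le_of_admissible hu hp k).trans ?_
    simp [div_eq_mul_inv]
  · simp only [perron, norm_neg]
    refine (h.summable_shear_and_norm_le hu hp n).2.trans ?_
    rw [div_le_div_iff₀ (by positivity) (by positivity)]
    have := h.one_le_K
    nlinarith

/-- The weights match the natural scales u ~ L and w ~ 1/L, so the scaled Lipschitz estimate applies
at every time with the same A. The gain comes from the drift being O(K/L) and the shear O(K/L³). -/
theorem near_perron (h : HasBounds F K R) (hF : Differentiable ℂ F) {u : ℂ} (hu : 2 * R < u.re)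
    {p q : ℕ → ℂ × ℂ} (hp : Admissible u p) (hq : Admissible u q) {A : ℝ} (hA : 0 < A)
    (hpq : Near u A p q) : Near u (A / 2) (perron F u p) (perron F u q) := by
  have hK := h.one_le_K
  have hR := h.R_pos
  have range : ∀ n (x : ℂ × ℂ), level u n / 2 ≤ ‖x.1‖ → ‖x.2‖ ≤ 2 / level u n →
      R ≤ ‖x.1‖ ∧ ‖x.2‖ ≤ 1 / R ∧ ‖x.1‖⁻¹ ≤ 2 / level u n := by
    intro n x h1 h2
    have hL := (h.le_level hu n).2
    have hL1 := h.one_le_level hu n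
    refine ⟨by linarith, h2.trans ?_, ?_⟩
    · rw [div_le_div_iff₀ (by linarith) hR]; linarith
    · rw [← inv_div]; exact inv_anti₀ (by linarith) h1
  have hdrift : ∀ n, ‖drift F (p n) - drift F (q n)‖ ≤ 2 * A * (4 * K / level u n) := by
    intro n
    have hL1 := h.one_le_level hu n
    refine norm_sub_le_of_scaled (L := level u n) (by linarith) hA (fun x h1 h2 => ?_)
      (fun x h1 h2 => ?_) (hp.level_le_re n) (hp n).2 (hq.level_le_re n) (hq n).2 (hpq n).1 (hpq n).2
    · obtain ⟨a, b, -⟩ := range n x h1 h2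
      exact h.differentiableAt_drift hF a b
    · obtain ⟨a, b, c⟩ := range n x h1 h2
      refine (h.drift_le _ _ a b).trans ?_
      calc _ ≤ K * (2 / level u n + 2 / level u n) := by gcongr
        _ = 4 * K / level u n := by ring
  have hshear : ∀ n, ‖shear F (p n) - shear F (q n)‖ ≤ 2 * A * (64 * K / level u n ^ 3) := by
    intro n
    have hL1 := h.one_le_level hu n
    refine norm_sub_le_of_scaled (L := level u n) (by linarith) hA (fun x h1 h2 => ?_)
      (fun x h1 h2 => ?_) (hp.level_le_re n) (hp n).2 (hq.level_le_re n) (hq n).2 (hpq n).1 (hpq n).2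
    · obtain ⟨a, b, -⟩ := range n x h1 h2
      exact h.differentiableAt_shear hF a
    · obtain ⟨a, b, c⟩ := range n x h1 h2
      refine (h.norm_shear_le a b).trans ?_
      calc _ ≤ 2 * K * (2 / level u n * (2 / level u n + 2 / level u n) ^ 2) := by gcongr
        _ = 64 * K / level u n ^ 3 := by field_simp; ring
  intro n
  have hL1 := h.one_le_level hu n
  have hL2 := (h.le_level hu n).1
  have hn : (0 : ℝ) ≤ n := Nat.cast_nonneg n
  constructor
  · simp only [perron, add_sub_add_left_eq_sub, ← Finset.sum_sub_distrib]
    -- Summed over k < n this gives nA/4, which is exactly the part of (A/2)·`level u n` contributed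
    -- by n/2.
    have hb : ∀ k ∈ Finset.range n, ‖drift F (p k) - drift F (q k)‖ ≤ A / 4 := by
      intro k _
      refine (hdrift k).trans ?_
      have h1 := (h.le_level hu k).1
      have h2 := h.one_le_level hu k
      have : 4 * K / level u k ≤ 1 / 8 := by
        rw [div_le_div_iff₀ (by linarith) (by norm_num)]; linarith
      nlinarith
    refine (norm_sum_le_of_le _ hb).trans ?_
    simp only [Finset.sum_const, Finset.card_range, nsmul_eq_mul, level]
    have : 0 < u.re := by linarith
    nlinarith [mul_pos hA this]
  · obtain ⟨sp, -⟩ := h.summable_shear_and_norm_le hu hp n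
    obtain ⟨sq, -⟩ := h.summable_shear_and_norm_le hu hq n
    have e : (perron F u p n).2 - (perron F u q n).2 =
        -∑' k, (shear F (p (n + k)) - shear F (q (n + k))) := by
      rw [sp.tsum_sub sq]; simp only [perron]; ring
    rw [e, norm_neg]
    -- The tail of these terms is at most 512AK/L², hence at most (A/2)/L because L ≥ 2000K.
    have hb : ∀ k : ℕ, ‖shear F (p (n + k)) - shear F (q (n + k))‖ ≤
        128 * A * K / (level u n + k / 2) ^ (1 + 2) := by
      intro k
      rw [← level_add]
      exact (hshear (n + k)).trans (le_of_eq (by ring))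
    refine (summable_and_norm_tsum_le 1 hL1 hb).2.trans ?_
    rw [div_le_div_iff₀ (by positivity) (by positivity)]
    have : 4 * (128 * A * K) * level u n = A * (level u n * (512 * K)) := by ring
    rw [this, div_mul_eq_mul_div, le_div_iff₀ (by norm_num), mul_assoc]
    refine mul_le_mul_of_nonneg_left ?_ hA.le
    rw [mul_assoc, show (1 + 1) = 2 from rfl, pow_two]
    exact mul_le_mul_of_nonneg_left (by linarith) (by linarith)

theorem admissible_picard (h : HasBounds F K R) {u : ℂ} (hu : 2 * R < u.re) (m : ℕ) :
    Admissible u (picard F u m) := by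
  induction m with
  | zero =>
    intro n
    have := h.one_le_level hu n
    simp only [picard, sub_self, norm_zero]
    constructor <;> positivity
  | succ m ih => exact h.admissible_perron hu ih

theorem near_picard (h : HasBounds F K R) (hF : Differentiable ℂ F) {u : ℂ} (hu : 2 * R < u.re)
    (m : ℕ) : Near u (2 / 2 ^ m) (picard F u m) (picard F u (m + 1)) := by
  induction m with
  | zero =>
    have := h.R_pos
    simpa using (h.admissible_picard hu 0).near (by linarith) (h.admissible_picard hu 1)
  | succ m ih =>
    have := h.near_perron hF hu (h.admissible_picard hu m) (h.admissible_picard hu (m + 1))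
      (by positivity) ih
    rwa [div_div, ← pow_succ] at this

/-- Successive Picard iterates are within 2/2ᵐ in the weighted distance, so each coordinate
converges geometrically with error 4/2ᵐ. The contraction then identifies the limit with its own
image. -/
theorem exists_perron_eq (h : HasBounds F K R) (hF : Differentiable ℂ F) {u : ℂ}
    (hu : 2 * R < u.re) : ∃ p, Admissible u p ∧ perron F u p = p ∧
      ∀ m, Near u (4 / 2 ^ m) (picard F u m) p := by
  have hn := h.near_picard hF hu
  have hd1 : ∀ n m, dist (picard F u m n).1 (picard F u (m + 1) n).1 ≤
      (4 * level u n) / 2 / 2 ^ m := fun n m => by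
    rw [dist_eq_norm]; exact (hn m n).1.trans (le_of_eq (by ring))
  have hd2 : ∀ n m, dist (picard F u m n).2 (picard F u (m + 1) n).2 ≤
      (4 / level u n) / 2 / 2 ^ m := fun n m => by
    rw [dist_eq_norm]; exact (hn m n).2.trans (le_of_eq (by ring))
  choose a ha using fun n => cauchySeq_tendsto_of_complete (cauchySeq_of_le_geometric_two (hd1 n))
  choose b hb using fun n => cauchySeq_tendsto_of_complete (cauchySeq_of_le_geometric_two (hd2 n))
  have hnear : ∀ m, Near u (4 / 2 ^ m) (picard F u m) (fun n => (a n, b n)) := by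
    intro m n
    constructor
    · have := dist_le_of_le_geometric_two_of_tendsto (hd1 n) (ha n) m
      rw [dist_eq_norm] at this
      exact this.trans (le_of_eq (by ring))
    · have := dist_le_of_le_geometric_two_of_tendsto (hd2 n) (hb n) m
      rw [dist_eq_norm] at this
      exact this.trans (le_of_eq (by ring))
  have hadm : Admissible u (fun n => (a n, b n)) := fun n =>
    ⟨le_of_tendsto ((ha n).sub_const _).norm (Eventually.of_forall fun m =>
        (h.admissible_picard hu m n).1),
      le_of_tendsto (hb n).norm (Eventually.of_forall fun m => (h.admissible_picard hu m n).2)⟩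
  refine ⟨fun n => (a n, b n), hadm, ?_, hnear⟩
  have hstep : ∀ m, Near u (4 / 2 ^ m / 2) (picard F u (m + 1)) (perron F u fun n => (a n, b n)) :=
    fun m => h.near_perron hF hu (h.admissible_picard hu m) hadm (by positivity) (hnear m)
  have h0 : Tendsto (fun m : ℕ => (4 : ℝ) / 2 ^ m / 2) atTop (𝓝 0) := by
    have := (tendsto_pow_atTop_nhds_zero_of_lt_one (r := (1 / 2 : ℝ)) (by norm_num)
      (by norm_num)).const_mul 2
    rw [mul_zero] at this
    refine this.congr fun m => ?_
    rw [one_div_pow]; ring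
  funext n
  ext1
  · refine tendsto_nhds_unique ?_ ((tendsto_add_atTop_iff_nat 1).2 (ha n))
    rw [tendsto_iff_norm_sub_tendsto_zero]
    refine squeeze_zero (fun _ => norm_nonneg _) (fun m => (hstep m n).1) ?_
    simpa using h0.mul_const (level u n)
  · refine tendsto_nhds_unique ?_ ((tendsto_add_atTop_iff_nat 1).2 (hb n))
    rw [tendsto_iff_norm_sub_tendsto_zero]
    refine squeeze_zero (fun _ => norm_nonneg _) (fun m => (hstep m n).2) ?_
    simpa using h0.div_const (level u n)

/-- Any two admissible sequences are at weighted distance at most 2; applying the contraction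
repeatedly halves this without end. -/
theorem eq_of_perron_eq (h : HasBounds F K R) (hF : Differentiable ℂ F) {u : ℂ}
    (hu : 2 * R < u.re) {p q : ℕ → ℂ × ℂ} (hp : Admissible u p) (hq : Admissible u q)
    (hp' : perron F u p = p) (hq' : perron F u q = q) : p = q := by
  have hn : ∀ m : ℕ, Near u (2 / 2 ^ m) p q := by
    intro m
    induction m with
    | zero =>
      have := h.R_pos
      simpa using hp.near (by linarith) hq
    | succ m ih =>
      have := h.near_perron hF hu hp hq (by positivity) ih
      rwa [div_div, ← pow_succ, hp', hq'] at this
  have h0 : Tendsto (fun m : ℕ => (2 : ℝ) / 2 ^ m) atTop (𝓝 0) := by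
    have := (tendsto_pow_atTop_nhds_zero_of_lt_one (r := (1 / 2 : ℝ)) (by norm_num)
      (by norm_num)).const_mul 2
    rw [mul_zero] at this
    refine this.congr fun m => ?_
    rw [one_div_pow]; ring
  funext n
  ext1
  · refine sub_eq_zero.1 (norm_le_zero_iff.1 ?_)
    refine ge_of_tendsto' (x := atTop) ?_ fun m => (hn m n).1
    simpa using h0.mul_const (level u n)
  · refine sub_eq_zero.1 (norm_le_zero_iff.1 ?_)
    refine ge_of_tendsto' (x := atTop) ?_ fun m => (hn m n).2
    simpa using h0.div_const (level u n)

theorem differentiableOn_picard (h : HasBounds F K R) (hF : Differentiable ℂ F) (m n : ℕ) :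
    DifferentiableOn ℂ (fun u => picard F u m n) {u | 2 * R < u.re} := by
  have hopen : IsOpen {u : ℂ | 2 * R < u.re} := isOpen_lt continuous_const Complex.continuous_re
  induction m generalizing n with
  | zero => exact ((differentiable_id.add_const _).prodMk (differentiable_const _)).differentiableOn
  | succ m ih =>
    simp only [picard, perron]
    refine DifferentiableOn.prodMk ?_ (DifferentiableOn.neg ?_)
    · refine (differentiable_id.add_const _).differentiableOn.add
        (DifferentiableOn.fun_sum fun k _ => ?_)
      intro u hu
      obtain ⟨-, h2, h3⟩ := h.admissible_range hu (h.admissible_picard hu m) k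
      exact (h.differentiableAt_drift hF h2 h3).comp_differentiableWithinAt u (ih k u hu)
    · have hR := h.R_pos
      have hK := h.one_le_K
      have hRK := h.le_R
      -- Only the summability of the majorant is wanted, so the series is taken to be 0. The
      -- majorant at 2R dominates the shear terms uniformly on the half-plane, as the Weierstrass
      -- test requires.
      have hs := (summable_and_norm_tsum_le (f := 0) (M := 8 * K) (x := 2 * R) 1 (by linarith)
        (fun k => by simp; positivity)).1
      refine Complex.differentiableOn_tsum_of_summable_norm hs (fun k => ?_) hopen ?_
      · intro u hu
        obtain ⟨-, h2, -⟩ := h.admissible_range hu (h.admissible_picard hu m) (n + k)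
        exact (h.differentiableAt_shear hF h2).comp_differentiableWithinAt u (ih (n + k) u hu)
      · intro k u hu
        refine (h.norm_shear_le_of_admissible hu (h.admissible_picard hu m) (n + k)).trans ?_
        have hu' : 2 * R < u.re := hu
        have hn : (0 : ℝ) ≤ n := Nat.cast_nonneg n
        have hk : (0 : ℝ) ≤ k := Nat.cast_nonneg k
        have : 2 * R + k / 2 ≤ level u (n + k) := by
          simp only [level]; push_cast; linarith
        gcongr

/-- Second-order bootstrap for the orbit on the parabolic curve. -/
theorem norm_snd_le_of_perron_eq (h : HasBounds F K R) {u : ℂ} (hu : 2 * R < u.re)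
    {p : ℕ → ℂ × ℂ} (hp : Admissible u p) (hp' : perron F u p = p) (n : ℕ) :
    ‖(p n).2‖ ≤ 36 * K / level u n ^ 3 := by
  have hK := h.one_le_K
  -- First pass: w = O(L⁻²). Then w²/u is O(L⁻⁵), the shear is O(L⁻⁴), and its tail sum is O(L⁻³).
  have h2 : ∀ n, ‖(p n).2‖ ≤ 32 * K / level u n ^ 2 := by
    intro n
    have := (h.summable_shear_and_norm_le hu hp n).2
    rw [← norm_neg] at this
    rwa [← hp']
  have hb : ∀ n, ‖shear F (p n)‖ ≤ 9 * K / level u n ^ 4 := by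
    intro n
    obtain ⟨a, b, c⟩ := h.admissible_range hu hp n
    have hL1 := h.one_le_level hu n
    have hL2 := (h.le_level hu n).1
    have h4 : ‖(p n).1‖⁻¹ ≤ 1 / level u n := by
      rw [one_div]; exact inv_anti₀ (by linarith) a
    have e : shear F (p n) = (shear F (p n) - (p n).2 ^ 2 / (p n).1) + (p n).2 ^ 2 / (p n).1 := by
      ring
    rw [e]
    refine (norm_add_le _ _).trans ?_
    have s1 : ‖shear F (p n) - (p n).2 ^ 2 / (p n).1‖ ≤ 8 * K / level u n ^ 4 := by
      refine (h.shear_le _ _ b c).trans ?_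
      calc _ ≤ K * (1 / level u n * (1 / level u n + 1 / level u n) ^ 3) := by
            gcongr; exact (hp n).2
        _ = 8 * K / level u n ^ 4 := by field_simp; ring
    have s2 : ‖(p n).2 ^ 2 / (p n).1‖ ≤ K / level u n ^ 4 := by
      rw [norm_div, norm_pow, div_eq_inv_mul]
      calc _ ≤ 1 / level u n * (32 * K / level u n ^ 2) ^ 2 := by gcongr; exact h2 n
        _ = 1024 * K / level u n * (K / level u n ^ 4) := by field_simp; ring
        _ ≤ 1 * (K / level u n ^ 4) := by
            gcongr
            rw [div_le_one (by linarith)]; linarith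
        _ = K / level u n ^ 4 := one_mul _
    calc _ ≤ 8 * K / level u n ^ 4 + K / level u n ^ 4 := add_le_add s1 s2
      _ = _ := by ring
  have hb' : ∀ k : ℕ, ‖shear F (p (n + k))‖ ≤ 9 * K / (level u n + k / 2) ^ (2 + 2) := by
    intro k
    rw [← level_add]
    exact hb (n + k)
  have := (summable_and_norm_tsum_le 2 (h.one_le_level hu n) hb').2
  rw [← norm_neg] at this
  rw [← hp']
  exact this.trans (le_of_eq (by ring))

/-- ψ(u) is the second component at time 0 of the unique fixed point over u. Uniform convergence of
the Picard iterates makes it holomorphic; invariance is uniqueness applied to the time-shifted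
sequence. -/
theorem exists_invariant_curve (h : HasBounds F K R) (hF : Differentiable ℂ F) :
    ∃ ψ : ℂ → ℂ, DifferentiableOn ℂ ψ {u | 2 * R < u.re} ∧ ∀ u : ℂ, 2 * R < u.re →
      ‖ψ u‖ ≤ 36 * K / u.re ^ 3 ∧ ‖drift F (u, ψ u)‖ ≤ 1 / 2 ∧
      ψ (u + 1 + drift F (u, ψ u)) = ψ u + shear F (u, ψ u) := by
  have hopen : IsOpen {u : ℂ | 2 * R < u.re} := isOpen_lt continuous_const Complex.continuous_re
  have hK := h.one_le_K
  have hR := h.R_pos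
  choose! p hadm hfix hnear using fun (u : ℂ) (hu : 2 * R < u.re) => h.exists_perron_eq hF hu
  have hp0 : ∀ u : ℂ, 2 * R < u.re → p u 0 = (u, (p u 0).2) := by
    intro u hu
    ext1
    · have := (hadm u hu 0).1
      simpa [sub_eq_zero] using this
    · rfl
  refine ⟨fun u => (p u 0).2, ?_, fun u hu => ?_⟩
  · have hlim : TendstoUniformlyOn (fun (m : ℕ) (u : ℂ) => (picard F u m 0).2)
        (fun u => (p u 0).2) atTop {u | 2 * R < u.re} := by
      rw [Metric.tendstoUniformlyOn_iff]
      intro ε hε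
      have h0 : Tendsto (fun m : ℕ => (4 : ℝ) * (1 / 2) ^ m) atTop (𝓝 0) := by
        simpa using (tendsto_pow_atTop_nhds_zero_of_lt_one (r := (1 / 2 : ℝ)) (by norm_num)
          (by norm_num)).const_mul 4
      filter_upwards [h0.eventually (gt_mem_nhds hε)] with m hm u hu
      rw [dist_comm, dist_eq_norm]
      refine ((hnear u hu m 0).2.trans ?_).trans_lt hm
      rw [one_div_pow, mul_one_div]
      exact div_le_self (by positivity) (h.one_le_level hu 0)
    exact hlim.tendstoLocallyUniformlyOn.differentiableOn
      (Eventually.of_forall fun m => (h.differentiableOn_picard hF m 0).snd) hopen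
  · have hd := h.norm_drift_le_of_admissible hu (hadm u hu) 0
    have hb := h.norm_snd_le_of_perron_eq hu (hadm u hu) (hfix u hu) 0
    rw [hp0 u hu] at hd
    refine ⟨by simpa [level] using hb, hd, ?_⟩
    set u' : ℂ := u + 1 + drift F (u, (p u 0).2) with hu'
    have hre : |(drift F (u, (p u 0).2)).re| ≤ 1 / 2 := (Complex.abs_re_le_norm _).trans hd
    have hre' : u'.re = u.re + 1 + (drift F (u, (p u 0).2)).re := by simp [hu']
    have hu'2 : 2 * R < u'.re := by rw [hre']; linarith [(abs_le.1 hre).1]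
    have hfst : ∀ n, (p u n).1 = u + n + ∑ k ∈ Finset.range n, drift F (p u k) := fun n => by
      conv_lhs => rw [← hfix u hu]
      rfl
    have hsnd : ∀ n, (p u n).2 = -∑' k, shear F (p u (n + k)) := fun n => by
      conv_lhs => rw [← hfix u hu]
      rfl
    -- The orbit shifted by one step solves the fixed-point problem over u', so it is the orbit
    -- chosen there.
    set q : ℕ → ℂ × ℂ := fun n => p u (n + 1) with hq
    have hqfix : perron F u' q = q := by
      funext n
      ext1
      · simp only [perron, hq]
        rw [hfst (n + 1), Finset.sum_range_succ', hu', hp0 u hu]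
        push_cast
        ring
      · simp only [perron, hq]
        rw [hsnd (n + 1)]
        congr 1
        refine tsum_congr fun k => ?_
        rw [add_right_comm]
    have hqadm : Admissible u' q := by
      intro n
      constructor
      · have e : (q n).1 - (u' + n) = ∑ k ∈ Finset.range n, drift F (p u (k + 1)) := by
          rw [← hqfix]
          simp [perron, hq]
        rw [e]
        refine (norm_sum_le_of_le _ fun k _ =>
          h.norm_drift_le_of_admissible hu (hadm u hu) (k + 1)).trans ?_
        simp [div_eq_mul_inv]
      -- `level u' n` may exceed `level u (n + 1)` by up to 1, so admissibility over u does not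
      -- transfer directly; the cubic decay supplies the slack.
      · refine (h.norm_snd_le_of_perron_eq hu (hadm u hu) (hfix u hu) (n + 1)).trans ?_
        have hL1 := h.one_le_level hu (n + 1)
        have hL2 := (h.le_level hu (n + 1)).1
        have hL1' := h.one_le_level hu'2 n
        have hle : level u' n ≤ 2 * level u (n + 1) := by
          have : level u' n ≤ level u (n + 1) + 1 := by
            simp only [level, hre']; push_cast; linarith [(abs_le.1 hre).2]
          linarith
        rw [div_le_div_iff₀ (by positivity) (by linarith), one_mul]
        set l := level u (n + 1)
        calc 36 * K * level u' n ≤ 36 * K * (2 * l) := by gcongr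
          _ = 72 * K * l * 1 := by ring
          _ ≤ l * l * l := by gcongr; linarith
          _ = l ^ 3 := by ring
    have hqp := h.eq_of_perron_eq hF hu'2 hqadm (hadm u' hu'2) hqfix (hfix u' hu'2)
    have h1 : p u' 0 = p u 1 := by rw [← hqp]
    have hsum := (h.summable_shear_and_norm_le hu (hadm u hu) 0).1
    have h0 := hsnd 0
    rw [hsum.tsum_eq_zero_add] at h0
    simp only [h1]
    rw [hsnd 1, ← hp0 u hu, h0]
    simp only [zero_add, add_comm 1]
    ring

end HasBounds
/-! ### Sectors -/

/-- Sectors become linear cone conditions, which also encode x ≠ 0 and behave well under addition.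
-/
theorem ne_zero_and_abs_arg_lt_iff {x : ℂ} {α : ℝ} (h0 : 0 < α) (h1 : α < Real.pi / 2) :
    (x ≠ 0 ∧ |Complex.arg x| < α) ↔ |x.im| < Real.tan α * x.re := by
  have ht : 0 < Real.tan α := Real.tan_pos_of_pos_of_lt_pi_div_two h0 h1
  have hα : α ∈ Set.Ioo (-(Real.pi / 2)) (Real.pi / 2) := ⟨by linarith, h1⟩
  have hα' : -α ∈ Set.Ioo (-(Real.pi / 2)) (Real.pi / 2) := ⟨by linarith, by linarith⟩
  have main : ∀ hre : 0 < x.re, (|Complex.arg x| < α ↔ |x.im| < Real.tan α * x.re) := by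
    intro hre
    have harg := abs_lt.1 (Complex.abs_arg_lt_pi_div_two_iff.2 (Or.inl hre))
    have hm : Complex.arg x ∈ Set.Ioo (-(Real.pi / 2)) (Real.pi / 2) := ⟨harg.1, harg.2⟩
    rw [abs_lt, abs_lt, ← Real.strictMonoOn_tan.lt_iff_lt hm hα,
      ← Real.strictMonoOn_tan.lt_iff_lt hα' hm, Complex.tan_arg, Real.tan_neg, div_lt_iff₀ hre,
      lt_div_iff₀ hre, neg_mul]
  constructor
  · rintro ⟨hx, ha⟩
    have hre : 0 < x.re :=
      (Complex.abs_arg_lt_pi_div_two_iff.1 (ha.trans h1)).resolve_right hx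
    exact (main hre).1 ha
  · intro h
    have hre : 0 < x.re := pos_of_mul_pos_right ((abs_nonneg _).trans_lt h) ht.le
    refine ⟨fun h0 => ?_, (main hre).2 h⟩
    rw [h0] at hre
    exact lt_irrefl _ hre

/-- The inverse is a positive multiple of the conjugate, so inversion preserves every cone symmetric
about the real axis. -/
theorem abs_im_inv_lt_iff {x : ℂ} {t : ℝ} : |x⁻¹.im| < t * x⁻¹.re ↔ |x.im| < t * x.re := by
  rcases eq_or_ne x 0 with rfl | hx
  · simp
  have h : 0 < Complex.normSq x := Complex.normSq_pos.2 hx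
  rw [Complex.inv_im, Complex.inv_re, abs_div, abs_neg, abs_of_pos h, ← mul_div_assoc,
    div_lt_div_iff_of_pos_right h]

theorem abs_im_inv_le_iff {x : ℂ} {t : ℝ} : |x⁻¹.im| ≤ t * x⁻¹.re ↔ |x.im| ≤ t * x.re := by
  rcases eq_or_ne x 0 with rfl | hx
  · simp
  have h : 0 < Complex.normSq x := Complex.normSq_pos.2 hx
  rw [Complex.inv_im, Complex.inv_re, abs_div, abs_neg, abs_of_pos h, ← mul_div_assoc,
    div_le_div_iff_of_pos_right h]

theorem mem_sector_iff {z : ℂ} {ε α : ℝ} (h0 : 0 < α) (h1 : α < Real.pi / 2) :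
    z ∈ sector ε α ↔ ‖z‖ < ε ∧ |(-z).im| < Real.tan α * (-z).re := by
  rw [← ne_zero_and_abs_arg_lt_iff h0 h1, sector, Set.mem_ofPred_eq, norm_pos_iff, neg_ne_zero]
  tauto

theorem mem_sector_iff_inv {z : ℂ} {ε α : ℝ} (h0 : 0 < α) (h1 : α < Real.pi / 2) :
    z ∈ sector ε α ↔ ‖z‖ < ε ∧ |(-z⁻¹).im| < Real.tan α * (-z⁻¹).re := by
  rw [mem_sector_iff h0 h1, ← inv_neg, abs_im_inv_lt_iff]

theorem norm_le_two_mul_re {x : ℂ} {t : ℝ} (ht0 : 0 < t) (ht : t ≤ 1) (h : |x.im| ≤ t * x.re) :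
    ‖x‖ ≤ 2 * x.re := by
  have hre : 0 ≤ x.re := nonneg_of_mul_nonneg_right ((abs_nonneg _).trans h) ht0
  have h1 := Complex.norm_le_abs_re_add_abs_im x
  rw [abs_of_nonneg hre] at h1
  nlinarith

theorem tan_le_one_of_le {α : ℝ} (h0 : 0 < α) (h : α ≤ Real.pi / 8) :
    0 < Real.tan α ∧ Real.tan α < 1 := by
  have hpi := Real.pi_pos
  refine ⟨Real.tan_pos_of_pos_of_lt_pi_div_two h0 (by linarith), ?_⟩
  rw [← Real.tan_pi_div_four]
  exact Real.tan_lt_tan_of_lt_of_lt_pi_div_two (by linarith) (by linarith) (by linarith)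

/-- A near-translation by `1` preserves sectors around the positive axis. -/
theorem abs_im_add_one_add_lt {u a : ℂ} {t : ℝ} (ht : t ≤ 1) (ha : ‖a‖ ≤ t / 2)
    (hu : |u.im| < t * u.re) : |(u + 1 + a).im| < t * (u + 1 + a).re := by
  have h1 := Complex.abs_im_le_norm a
  have h2 := (abs_le.1 (Complex.abs_re_le_norm a)).1
  have h3 : |(u + 1 + a).im| ≤ |u.im| + |a.im| := by simpa using abs_add_le u.im a.im
  have h4 := norm_nonneg a
  simp only [Complex.add_re, Complex.one_re]
  nlinarith

/-- |u + 1|² = |u|² + 2 Re u + 1 ≥ |u|² + |u| + 1 ≥ (|u| + 1/2)². -/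
theorem norm_add_one_add_ge {u a : ℂ} (hu : ‖u‖ ≤ 2 * u.re) :
    ‖u‖ + 1 / 2 - ‖a‖ ≤ ‖u + 1 + a‖ := by
  have h1 : ‖u‖ + 1 / 2 ≤ ‖u + 1‖ := by
    refine le_of_sq_le_sq ?_ (norm_nonneg _)
    have e1 := Complex.sq_norm u
    have e2 := Complex.sq_norm (u + 1)
    rw [Complex.normSq_apply] at e1 e2
    simp only [Complex.add_re, Complex.one_re, Complex.add_im, Complex.one_im] at e2
    nlinarith [norm_nonneg u]
  have := norm_sub_le (u + 1 + a) a
  rw [add_sub_cancel_right] at this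
  linarith

/-! ### The parabolic curve -/

/-- `u ↦ (u, ψ u)` is an invariant curve of `F` over a half-plane, in the coordinate `u = -1/z`. -/
structure IsInvariantCurve (F : ℂ × ℂ → ℂ × ℂ) (K R : ℝ) (ψ : ℂ → ℂ) : Prop where
  differentiableOn : DifferentiableOn ℂ ψ {u | 2 * R < u.re}
  map_zero : ψ 0 = 0
  norm_le : ∀ u : ℂ, 2 * R < u.re → ‖ψ u‖ ≤ 36 * K / u.re ^ 3
  map_eq : ∀ u : ℂ, 2 * R < u.re → 2 * R < (u + 1 + drift F (u, ψ u)).re →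
    ψ (u + 1 + drift F (u, ψ u)) = ψ u + shear F (u, ψ u)

theorem HasBounds.exists_isInvariantCurve {F : ℂ × ℂ → ℂ × ℂ} {K R : ℝ} (h : HasBounds F K R)
    (hF : Differentiable ℂ F) : ∃ ψ, IsInvariantCurve F K R ψ := by
  obtain ⟨ψ, h1, h2⟩ := h.exists_invariant_curve hF
  classical
  have hin : ∀ u : ℂ, 2 * R < u.re → Set.indicator {u : ℂ | 2 * R < u.re} ψ u = ψ u :=
    fun u hu => Set.indicator_of_mem (s := {u : ℂ | 2 * R < u.re}) hu ψ
  -- Extension by zero makes ψ vanish at 0. With the convention 0⁻¹ = 0, the function ψ(-z⁻¹) then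
  -- takes the required value 0 at z = 0.
  refine ⟨Set.indicator {u | 2 * R < u.re} ψ, h1.congr fun u hu => hin u hu, ?_, fun u hu => ?_,
    fun u hu => ?_⟩
  · have := h.R_pos
    exact Set.indicator_of_notMem (by simp; linarith) ψ
  · rw [hin u hu]; exact (h2 u hu).1
  · rw [hin u hu]
    intro hu'
    rw [hin _ hu']
    exact (h2 u hu).2.2

namespace IsInvariantCurve
variable {F : ℂ × ℂ → ℂ × ℂ} {K R : ℝ} {ψ : ℂ → ℂ}

theorem isOpen_halfPlane (R : ℝ) : IsOpen {u : ℂ | 2 * R < u.re} :=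
  isOpen_lt continuous_const Complex.continuous_re

theorem differentiableAt (hψ : IsInvariantCurve F K R ψ) {u : ℂ} (hu : 2 * R < u.re) :
    DifferentiableAt ℂ ψ u :=
  (hψ.differentiableOn u hu).differentiableAt ((isOpen_halfPlane R).mem_nhds hu)

theorem norm_deriv_le (hψ : IsInvariantCurve F K R ψ) (h : HasBounds F K R) {u : ℂ}
    (hu : 4 * R ≤ u.re) : ‖deriv ψ u‖ ≤ 576 * K / u.re ^ 4 := by
  have hR := h.R_pos
  have hK := h.one_le_K
  have hu0 : 0 < u.re := by linarith
  have hin : ∀ x ∈ Metric.ball u (u.re / 2), u.re / 2 < x.re := by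
    intro x hx
    rw [mem_ball_iff_norm] at hx
    have := (abs_lt.1 ((Complex.abs_re_le_norm (x - u)).trans_lt hx)).1
    rw [Complex.sub_re] at this
    linarith
  have hb : ∀ x ∈ Metric.ball u (u.re / 2), ‖ψ x‖ ≤ 288 * K / u.re ^ 3 := by
    intro x hx
    have h1 := hin x hx
    refine (hψ.norm_le x (by linarith)).trans ?_
    calc 36 * K / x.re ^ 3 ≤ 36 * K / (u.re / 2) ^ 3 := by gcongr
      _ = 288 * K / u.re ^ 3 := by field_simp; ring
  -- When Re u = 4R, the closed disc of radius Re u/2 touches the line Re = 2R, so Cauchy's estimate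
  -- is applied to smaller radii and passed to the limit.
  have key : ∀ ρ : ℝ, 0 < ρ → ρ < u.re / 2 → ‖deriv ψ u‖ ≤ 288 * K / u.re ^ 3 / ρ := by
    intro ρ hρ hρ'
    have hsub : Metric.closedBall u ρ ⊆ Metric.ball u (u.re / 2) :=
      Metric.closedBall_subset_ball hρ'
    refine Complex.norm_deriv_le_of_forall_mem_sphere_norm_le hρ
      (DifferentiableOn.diffContOnCl ?_) fun x hx => hb x (hsub (Metric.sphere_subset_closedBall hx))
    rw [closure_ball _ hρ.ne']
    intro x hx
    have := hin x (hsub hx)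
    exact (hψ.differentiableAt (by linarith)).differentiableWithinAt
  have hlim : Tendsto (fun ρ : ℝ => 288 * K / u.re ^ 3 / ρ) (𝓝[<] (u.re / 2))
      (𝓝 (288 * K / u.re ^ 3 / (u.re / 2))) :=
    (tendsto_const_nhds.div tendsto_id (by positivity)).mono_left nhdsWithin_le_nhds
  have hfin : ‖deriv ψ u‖ ≤ 288 * K / u.re ^ 3 / (u.re / 2) := by
    refine ge_of_tendsto hlim ?_
    filter_upwards [Ioo_mem_nhdsLT (show 0 < u.re / 2 by linarith)] with ρ hρ
    exact key ρ hρ.1 hρ.2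
  refine hfin.trans (le_of_eq ?_)
  field_simp
  ring

/-- The curve lies in the domain of the estimates, and `F` is close to the translation there. -/
theorem range (hψ : IsInvariantCurve F K R ψ) (h : HasBounds F K R) {u : ℂ} (hu : 2 * R < u.re) :
    R ≤ ‖u‖ ∧ ‖ψ u‖ ≤ 1 / R ∧ ‖drift F (u, ψ u)‖ ≤ 1 / 8 := by
  have hR := h.R_pos
  have hK := h.one_le_K
  have hRK := h.le_R
  have hu0 : 2000 * K < u.re := by linarith
  have hre := Complex.re_le_norm u
  have h1 : ‖ψ u‖ ≤ 1 / u.re := by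
    refine (hψ.norm_le u hu).trans ?_
    have hu1 : 0 < u.re := by linarith
    rw [div_le_div_iff₀ (by positivity) hu1]
    calc 36 * K * u.re ≤ u.re * u.re := mul_le_mul_of_nonneg_right (by linarith) (by linarith)
      _ ≤ 1 * (u.re * u.re * u.re) := by nlinarith [mul_self_nonneg u.re]
      _ = 1 * u.re ^ 3 := by ring
  have h2 : ‖ψ u‖ ≤ 1 / R := h1.trans (one_div_le_one_div_of_le hR (by linarith))
  refine ⟨by linarith, h2, (h.drift_le u _ (by linarith) h2).trans ?_⟩
  calc K * (‖u‖⁻¹ + ‖ψ u‖) ≤ K * (1 / u.re + 1 / u.re) := by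
        gcongr
        rw [one_div]; exact inv_anti₀ (by linarith) hre
    _ = 2 * K / u.re := by ring
    _ ≤ 1 / 8 := by rw [div_le_div_iff₀ (by linarith) (by norm_num)]; linarith

theorem step (hψ : IsInvariantCurve F K R ψ) (h : HasBounds F K R) {u : ℂ} (hu : 2 * R < u.re) :
    u.re + 1 / 2 ≤ (u + 1 + drift F (u, ψ u)).re ∧
    F (-u⁻¹, ψ u) = (-(u + 1 + drift F (u, ψ u))⁻¹, ψ (u + 1 + drift F (u, ψ u))) := by
  obtain ⟨h1, h2, h3⟩ := hψ.range h hu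
  have h4 := (abs_le.1 ((Complex.abs_re_le_norm (drift F (u, ψ u))).trans h3)).1
  have h5 : u.re + 1 / 2 ≤ (u + 1 + drift F (u, ψ u)).re := by
    simp only [Complex.add_re, Complex.one_re]; linarith
  refine ⟨h5, ?_⟩
  rw [h.apply_eq h1 h2, hψ.map_eq u hu (by linarith)]

theorem norm_le_of_abs_im_le (hψ : IsInvariantCurve F K R ψ) (h : HasBounds F K R) {u : ℂ}
    (hu : 2 * R < u.re) (hc : ‖u‖ ≤ 2 * u.re) : ‖ψ u‖ ≤ 288 * K * ‖u‖⁻¹ ^ 3 := by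
  have hR := h.R_pos
  have hK := h.one_le_K
  have hu0 : 0 < ‖u‖ := by linarith [Complex.re_le_norm u]
  refine (hψ.norm_le u hu).trans ?_
  calc 36 * K / u.re ^ 3 ≤ 36 * K / (‖u‖ / 2) ^ 3 := by gcongr; linarith
    _ = 288 * K * ‖u‖⁻¹ ^ 3 := by field_simp; ring

/-- The orbits on the curve, over a sector. -/
theorem attractedAlong (hψ : IsInvariantCurve F K R ψ) (h : HasBounds F K R) {t : ℝ}
    (ht0 : 1 / 4 ≤ t) (ht : t ≤ 1) {u : ℂ} (hu : 2 * R < u.re) (hc : |u.im| < t * u.re) :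
    AttractedAlong F (1, 0) (-u⁻¹, ψ u) := by
  have hR := h.R_pos
  set N : ℂ → ℂ := fun u => u + 1 + drift F (u, ψ u) with hN
  have hiter : ∀ n : ℕ, u.re + n / 2 ≤ (N^[n] u).re ∧ |(N^[n] u).im| < t * (N^[n] u).re ∧
      F^[n] (-u⁻¹, ψ u) = (-(N^[n] u)⁻¹, ψ (N^[n] u)) := by
    intro n
    induction n with
    | zero => simpa using hc
    | succ n ih =>
      obtain ⟨h1, h2, h3⟩ := ih
      have hn : (0 : ℝ) ≤ n := Nat.cast_nonneg n
      have hu' : 2 * R < (N^[n] u).re := by linarith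
      obtain ⟨h4, h5⟩ := hψ.step h hu'
      rw [Function.iterate_succ_apply', Function.iterate_succ_apply', h3, h5]
      refine ⟨?_, abs_im_add_one_add_lt ht ((hψ.range h hu').2.2.trans (by linarith)) h2, rfl⟩
      push_cast
      simp only [hN]
      linarith
  have hretop : Tendsto (fun n : ℕ => (N^[n] u).re) atTop atTop := by
    refine tendsto_atTop_mono (fun n => (hiter n).1) ?_
    exact tendsto_atTop_add_const_left _ _
      (tendsto_natCast_atTop_atTop.atTop_div_const (by norm_num))
  have hnormtop : Tendsto (fun n : ℕ => ‖N^[n] u‖) atTop atTop :=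
    tendsto_atTop_mono (fun n => Complex.re_le_norm _) hretop
  have hinv : Tendsto (fun n : ℕ => ‖N^[n] u‖⁻¹) atTop (𝓝 0) := tendsto_inv_atTop_zero.comp hnormtop
  have hre : ∀ n, 2 * R < (N^[n] u).re := fun n => by
    have hn : (0 : ℝ) ≤ n := Nat.cast_nonneg n
    linarith [(hiter n).1]
  have hne : ∀ n, N^[n] u ≠ 0 := fun n h0 => by
    have := hre n
    rw [h0, Complex.zero_re] at this
    linarith
  have hψb : ∀ n, ‖ψ (N^[n] u)‖ ≤ 288 * K * ‖N^[n] u‖⁻¹ ^ 3 := fun n =>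
    hψ.norm_le_of_abs_im_le h (hre n)
      (norm_le_two_mul_re (by linarith) ht (hiter n).2.1.le)
  refine ⟨?_, Eventually.of_forall fun n h0 => ?_, fun n => -N^[n] u, ?_⟩
  · simp only [fun n => (hiter n).2.2]
    rw [Prod.zero_eq_mk]
    refine Tendsto.prodMk_nhds ?_ ?_
    · rw [tendsto_zero_iff_norm_tendsto_zero]
      simpa using hinv
    · refine squeeze_zero_norm hψb ?_
      simpa using (hinv.pow 3).const_mul (288 * K)
  · rw [(hiter n).2.2] at h0
    have := congrArg Prod.fst h0
    simp [hne n] at this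
  · simp only [fun n => (hiter n).2.2, Prod.smul_mk, smul_eq_mul]
    refine Tendsto.prodMk_nhds ?_ ?_
    · refine tendsto_const_nhds.congr fun n => ?_
      field_simp [hne n]
    · refine squeeze_zero_norm (a := fun n => 288 * K * ‖N^[n] u‖⁻¹ ^ 2) (fun n => ?_) ?_
      · rw [norm_mul, norm_neg]
        have hp : 0 < ‖N^[n] u‖ := norm_pos_iff.2 (hne n)
        calc _ ≤ ‖N^[n] u‖ * (288 * K * ‖N^[n] u‖⁻¹ ^ 3) := by gcongr; exact hψb n
          _ = _ := by field_simp
      · simpa using (hinv.pow 2).const_mul (288 * K)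

/-- Everything is transported through z = -1/u. The bound O(|u|⁻³) becomes O(|z|³), and ψ' =
O(|u|⁻⁴) loses the factor z⁻² of the chain rule. -/
theorem isParabolicGraph (hψ : IsInvariantCurve F K R ψ) (h : HasBounds F K R) {ε : ℝ}
    (hεR : ε ≤ 1 / (8 * R)) :
    IsParabolicGraph F (fun z => ψ (-z⁻¹)) ε := by
  have hR := h.R_pos
  have hK := h.one_le_K
  have hpi := Real.pi_pos
  have hpi3 := Real.pi_gt_three
  set t := Real.tan (Real.pi / 8) with ht
  obtain ⟨ht0, ht1⟩ := tan_le_one_of_le (by linarith : 0 < Real.pi / 8) le_rfl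
  rw [← ht] at ht0 ht1
  have ht4 : 1 / 4 ≤ t := by
    have := Real.le_tan (x := Real.pi / 8) (by linarith) (by linarith)
    linarith
  have hV : ∀ z, z ∈ V ε ↔ ‖z‖ < ε ∧ |(-z⁻¹).im| < t * (-z⁻¹).re := fun z =>
    mem_sector_iff_inv (by linarith) (by linarith)
  -- The radius 1/(8R) gives |u| ≥ 8R, and the cone gives Re u ≥ |u|/2 ≥ 4R, the margin needed for
  -- the derivative bound. Non-strict inequalities cover the closure of the sector.
  have hclosed : ∀ z : ℂ, z ≠ 0 → ‖z‖ ≤ ε → |(-z⁻¹).im| ≤ t * (-z⁻¹).re →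
      4 * R ≤ (-z⁻¹).re ∧ ‖-z⁻¹‖ ≤ 2 * (-z⁻¹).re := by
    intro z hz hzε hc
    have h1 := norm_le_two_mul_re ht0 ht1.le hc
    have h2 : 8 * R ≤ ‖-z⁻¹‖ := by
      rw [norm_neg, norm_inv, ← one_div, le_div_iff₀ (norm_pos_iff.2 hz)]
      rw [le_div_iff₀ (by linarith)] at hεR
      nlinarith
    exact ⟨by linarith, h1⟩
  have hne : ∀ z ∈ V ε, z ≠ 0 := fun z hz => norm_pos_iff.1 hz.1
  have hVre : ∀ z ∈ V ε, 4 * R ≤ (-z⁻¹).re ∧ ‖-z⁻¹‖ ≤ 2 * (-z⁻¹).re := fun z hz =>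
    hclosed z (hne z hz) ((hV z).1 hz).1.le ((hV z).1 hz).2.le
  have hder : ∀ z : ℂ, z ≠ 0 → 4 * R ≤ (-z⁻¹).re →
      HasDerivAt (fun z => ψ (-z⁻¹)) (deriv ψ (-z⁻¹) * (z ^ 2)⁻¹) z := by
    intro z hz hre
    have h1 : HasDerivAt (fun z : ℂ => -z⁻¹) ((z ^ 2)⁻¹) z := by
      simpa using (hasDerivAt_inv hz).fun_neg
    exact (hψ.differentiableAt (by linarith)).hasDerivAt.comp z h1
  have hsize : ∀ z : ℂ, 4 * R ≤ (-z⁻¹).re → ‖-z⁻¹‖ ≤ 2 * (-z⁻¹).re →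
      ‖ψ (-z⁻¹)‖ ≤ 288 * K * ‖z‖ ^ 3 := by
    intro z h1 h2
    simpa using hψ.norm_le_of_abs_im_le h (by linarith) h2
  have hopen : IsOpen (V ε) := by
    have : V ε = {z : ℂ | ‖z‖ < ε ∧ |(-z).im| < t * (-z).re} := by
      ext z; exact mem_sector_iff (by linarith) (by linarith)
    rw [this]
    exact (isOpen_lt continuous_norm continuous_const).inter
      (isOpen_lt (Complex.continuous_im.comp continuous_neg).abs
        (continuous_const.mul (Complex.continuous_re.comp continuous_neg)))
  refine ⟨?_, ?_, by simpa using hψ.map_zero, ?_, ?_, ⟨288 * K, ?_⟩, ⟨9216 * K, ?_⟩⟩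
  · exact DifferentiableOn.analyticOnNhd
      (fun z hz => (hder z (hne z hz) (hVre z hz).1).differentiableAt.differentiableWithinAt) hopen
  · have hcl : closure (V ε) ⊆ {z : ℂ | ‖z‖ ≤ ε ∧ |(-z).im| ≤ t * (-z).re} := by
      refine closure_minimal (fun z hz => ?_) ?_
      · have := (mem_sector_iff (by linarith) (by linarith)).1 (show z ∈ sector ε _ from hz)
        exact ⟨this.1.le, this.2.le⟩
      · exact (isClosed_le continuous_norm continuous_const).inter
          (isClosed_le (Complex.continuous_im.comp continuous_neg).abs
            (continuous_const.mul (Complex.continuous_re.comp continuous_neg)))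
    have hcl' : ∀ z ∈ closure (V ε), z ≠ 0 →
        4 * R ≤ (-z⁻¹).re ∧ ‖-z⁻¹‖ ≤ 2 * (-z⁻¹).re := by
      intro z hz hz0
      obtain ⟨h1, h2⟩ := hcl hz
      refine hclosed z hz0 h1 ?_
      rwa [← inv_neg, abs_im_inv_le_iff]
    intro z hz
    rcases eq_or_ne z 0 with rfl | hz0
    · rw [ContinuousWithinAt, show ψ (-(0 : ℂ)⁻¹) = 0 by simpa using hψ.map_zero]
      refine squeeze_zero_norm' (a := fun z : ℂ => 288 * K * ‖z‖ ^ 3) ?_ ?_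
      · filter_upwards [self_mem_nhdsWithin] with z hz
        rcases eq_or_ne z 0 with rfl | hz0
        · simp [hψ.map_zero]
        · exact hsize z (hcl' z hz hz0).1 (hcl' z hz hz0).2
      · have : Continuous fun z : ℂ => 288 * K * ‖z‖ ^ 3 := by fun_prop
        simpa using (this.tendsto 0).mono_left nhdsWithin_le_nhds
    · exact (hder z hz0 (hcl' z hz hz0).1).continuousAt.continuousWithinAt
  · intro z hz
    have hre := (hVre z hz).1
    have h2R : 2 * R < (-z⁻¹).re := by linarith
    obtain ⟨h1, h2⟩ := hψ.step h h2R
    obtain ⟨-, -, h3⟩ := hψ.range h h2R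
    set u : ℂ := -z⁻¹ with hu
    have hzu : z = -u⁻¹ := by rw [hu]; simp
    set u' : ℂ := u + 1 + drift F (u, ψ u) with hu'
    refine ⟨-u'⁻¹, ?_, ?_⟩
    · rw [hV]
      have hb := norm_add_one_add_ge (a := drift F (u, ψ u)) (hVre z hz).2
      have hu0 : 0 < ‖u‖ := by linarith [Complex.re_le_norm u]
      constructor
      · refine lt_trans ?_ ((hV z).1 hz).1
        rw [hzu, norm_neg, norm_neg, norm_inv, norm_inv]
        exact inv_strictAnti₀ hu0 (by linarith)
      · rw [inv_neg, inv_inv, neg_neg]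
        exact abs_im_add_one_add_lt ht1.le (h3.trans (by linarith)) ((hV z).1 hz).2
    · rw [hzu]
      simpa using h2
  · intro z hz
    have := hψ.attractedAlong h ht4 ht1.le (u := -z⁻¹) (by linarith [(hVre z hz).1])
      ((hV z).1 hz).2
    simpa using this
  · exact fun z hz => hsize z (hVre z hz).1 (hVre z hz).2
  · intro z hz
    obtain ⟨h1, h2⟩ := hVre z hz
    have hz0 : 0 < ‖z‖ := hz.1
    rw [(hder z (hne z hz) h1).deriv, norm_mul, norm_inv, norm_pow]
    have hb := hψ.norm_deriv_le h h1
    rw [norm_neg, norm_inv] at h2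
    have hb2 : 576 * K / (-z⁻¹).re ^ 4 ≤ 9216 * K * ‖z‖ ^ 4 := by
      calc 576 * K / (-z⁻¹).re ^ 4 ≤ 576 * K / (‖z‖⁻¹ / 2) ^ 4 := by gcongr; linarith
        _ = 9216 * K * ‖z‖ ^ 4 := by field_simp; ring
    calc _ ≤ 9216 * K * ‖z‖ ^ 4 * (‖z‖ ^ 2)⁻¹ := by gcongr; exact hb.trans hb2
      _ = 9216 * K * ‖z‖ ^ 2 := by field_simp

end IsInvariantCurve
/-! ### The region -/

theorem isOpen_sector {ε α : ℝ} (h0 : 0 < α) (h1 : α < Real.pi / 2) : IsOpen (sector ε α) := by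
  have : sector ε α = {z : ℂ | ‖z‖ < ε ∧ |(-z).im| < Real.tan α * (-z).re} := by
    ext z; exact mem_sector_iff h0 h1
  rw [this]
  exact (isOpen_lt continuous_norm continuous_const).inter
    (isOpen_lt (Complex.continuous_im.comp continuous_neg).abs
      (continuous_const.mul (Complex.continuous_re.comp continuous_neg)))

theorem isOpen_region {γ : ℂ → ℂ} {ε α θ : ℝ} (hα0 : 0 < α) (hα : α < Real.pi / 2) (hθ0 : 0 < θ)
    (hθ : θ < Real.pi / 2) (hγ : ContinuousOn γ (sector ε α)) : IsOpen (region γ ε α θ) := by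
  have hA : IsOpen {p : ℂ × ℂ | p.1 ∈ sector ε α} := (isOpen_sector hα0 hα).preimage continuous_fst
  have hT : IsOpen {q : ℂ × ℂ | q.2 ∈ sector ε θ ∧ ‖q.1‖ < ‖q.2‖} :=
    ((isOpen_sector hθ0 hθ).preimage continuous_snd).inter
      (isOpen_lt continuous_fst.norm continuous_snd.norm)
  have hc : ContinuousOn (fun p : ℂ × ℂ => (p.1, p.2 - γ p.1)) {p | p.1 ∈ sector ε α} :=
    continuousOn_fst.prodMk (continuousOn_snd.sub (hγ.comp continuousOn_fst fun p hp => hp))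
  exact hc.isOpen_inter_preimage hA hT

theorem neg_exp_mem_sector {x : ℂ} {ε α : ℝ} (hε : 0 < ε) (hα : α < Real.pi) (h : |x.im| < α)
    (hx : x.re < Real.log ε) : -Complex.exp x ∈ sector ε α := by
  obtain ⟨h1, h2⟩ := abs_lt.1 (h.trans hα)
  refine ⟨by simp, ?_, ?_⟩
  · rw [norm_neg, Complex.norm_exp]
    exact (Real.lt_log_iff_exp_lt hε).1 hx
  · rwa [neg_neg, ← Complex.log_im, Complex.log_exp h1 h2.le]

/-- In logarithmic coordinates a = log(-z), b = log(-(w - γ(z))), all conditions are linear in real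
and imaginary parts. The region is a continuous image of a nonempty convex set. -/
theorem isConnected_region {γ : ℂ → ℂ} {ε α θ : ℝ} (hε : 0 < ε) (hα0 : 0 < α)
    (hα : α < Real.pi) (hθ0 : 0 < θ) (hθ : θ < Real.pi) (hγ : ContinuousOn γ (sector ε α)) :
    IsConnected (region γ ε α θ) := by
  set C : Set (ℂ × ℂ) := {q | |q.1.im| < α ∧ |q.2.im| < θ ∧ q.1.re < q.2.re ∧ q.2.re < Real.log ε}
    with hC
  have hconv : Convex ℝ C := by
    rintro ⟨a, b⟩ ⟨h1, h2, h3, h4⟩ ⟨a', b'⟩ ⟨h1', h2', h3', h4'⟩ s t hs ht hst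
    rw [abs_lt] at h1 h2 h1' h2'
    simp only at h1 h2 h3 h4 h1' h2' h3' h4'
    simp only [hC, Set.mem_ofPred_eq, Prod.smul_mk, Prod.mk_add_mk, Complex.add_re, Complex.add_im,
      Complex.real_smul, Complex.mul_re, Complex.mul_im, Complex.ofReal_re, Complex.ofReal_im,
      zero_mul, sub_zero, add_zero]
    obtain rfl : s = 1 - t := by linarith
    rcases ht.eq_or_lt with rfl | ht'
    · simp [abs_lt, *]
    have := mul_pos ht' (sub_pos.2 h1'.1)
    have := mul_pos ht' (sub_pos.2 h1'.2)
    have := mul_pos ht' (sub_pos.2 h2'.1)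
    have := mul_pos ht' (sub_pos.2 h2'.2)
    have := mul_pos ht' (sub_pos.2 h3')
    have := mul_pos ht' (sub_pos.2 h4')
    have := mul_nonneg hs (sub_pos.2 h1.1).le
    have := mul_nonneg hs (sub_pos.2 h1.2).le
    have := mul_nonneg hs (sub_pos.2 h2.1).le
    have := mul_nonneg hs (sub_pos.2 h2.2).le
    have := mul_nonneg hs (sub_pos.2 h3).le
    have := mul_nonneg hs (sub_pos.2 h4).le
    refine ⟨abs_lt.2 ⟨?_, ?_⟩, abs_lt.2 ⟨?_, ?_⟩, ?_, ?_⟩ <;> linarith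
  have hne : C.Nonempty := by
    refine ⟨(((Real.log ε - 2 : ℝ) : ℂ), ((Real.log ε - 1 : ℝ) : ℂ)), ?_, ?_, ?_, ?_⟩
    · simpa using hα0
    · simpa using hθ0
    · simp only [Complex.ofReal_re]; linarith
    · simp only [Complex.ofReal_re]; linarith
  have hsec : ∀ q ∈ C, -Complex.exp q.1 ∈ sector ε α := fun q hq =>
    neg_exp_mem_sector hε hα hq.1 (hq.2.2.1.trans hq.2.2.2)
  have hcont : ContinuousOn (fun q : ℂ × ℂ =>
      (-Complex.exp q.1, -Complex.exp q.2 + γ (-Complex.exp q.1))) C := by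
    have h1 : ContinuousOn (fun q : ℂ × ℂ => -Complex.exp q.1) C := by fun_prop
    exact h1.prodMk (ContinuousOn.add (by fun_prop) (hγ.comp h1 hsec))
  have himage : (fun q : ℂ × ℂ =>
      (-Complex.exp q.1, -Complex.exp q.2 + γ (-Complex.exp q.1))) '' C = region γ ε α θ := by
    ext ⟨z, w⟩
    constructor
    · rintro ⟨q, hq, hqz⟩
      obtain ⟨rfl, rfl⟩ := Prod.mk.inj hqz
      refine ⟨hsec q hq, ?_, ?_⟩
      · simp only [add_sub_cancel_right]
        exact neg_exp_mem_sector hε hθ hq.2.1 hq.2.2.2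
      · simp only [add_sub_cancel_right, norm_neg, Complex.norm_exp]
        exact Real.exp_lt_exp.2 hq.2.2.1
    · rintro ⟨h1, h2, h3⟩
      simp only at h1 h2 h3
      have hz : -z ≠ 0 := neg_ne_zero.2 (norm_pos_iff.1 h1.1)
      have hy : -(w - γ z) ≠ 0 := neg_ne_zero.2 (norm_pos_iff.1 h2.1)
      refine ⟨(Complex.log (-z), Complex.log (-(w - γ z))), ⟨?_, ?_, ?_, ?_⟩, ?_⟩
      · simpa [Complex.log_im] using h1.2.2
      · simpa only [Complex.log_im] using h2.2.2
      · simp only [Complex.log_re, norm_neg]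
        exact Real.log_lt_log h1.1 h3
      · simp only [Complex.log_re, norm_neg]
        exact Real.log_lt_log h2.1 h2.2.1
      · simp only [Complex.exp_log hz, Complex.exp_log hy, neg_neg, sub_add_cancel]
  rw [← himage]
  exact ⟨hne.image _, hconv.isPreconnected.image _ hcont⟩

/-! ### The map near the curve -/

/-- Coordinates `u = -1/z`, `v = -1/(w - ψ(u))` around the curve. -/
noncomputable def param (ψ : ℂ → ℂ) (q : ℂ × ℂ) : ℂ × ℂ := (-q.1⁻¹, -q.2⁻¹ + ψ q.1)

/-- If `y = -1/v` and `y' = y + y²/u + e`, then `-1/y'` is close to `v + 1/u`. -/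
theorem exists_eq_neg_inv {u v e : ℂ} {c : ℝ} (hvc : c ≤ ‖v‖) (hv : 4 ≤ ‖v‖)
    (huv : ‖v‖ ≤ ‖u‖) (he : ‖e‖ ≤ c * (‖u‖⁻¹ * ‖v‖⁻¹ ^ 3)) :
    ∃ b : ℂ, ‖b‖ ≤ 2 * (c + 1) * ‖v‖⁻¹ ∧ v + (1 + b) / u ≠ 0 ∧
      -v⁻¹ + (-v⁻¹) ^ 2 / u + e = -(v + (1 + b) / u)⁻¹ := by
  have hvp : 0 < ‖v‖ := by linarith
  have hup : 0 < ‖u‖ := by linarith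
  have hv0 : v ≠ 0 := norm_pos_iff.1 hvp
  have hu0 : u ≠ 0 := norm_pos_iff.1 hup
  -- With q = -(1 + k)/(vu), the new y is -(1 + q)/v, so -1/y' = v/(1 + q) = v + (1 + k)/((1 + q)u),
  -- and b = (k - q)/(1 + q).
  set k : ℂ := e * u * v ^ 2 with hk
  have hkn : ‖k‖ ≤ c * ‖v‖⁻¹ := by
    rw [hk, norm_mul, norm_mul, norm_pow]
    calc ‖e‖ * ‖u‖ * ‖v‖ ^ 2 ≤ c * (‖u‖⁻¹ * ‖v‖⁻¹ ^ 3) * ‖u‖ * ‖v‖ ^ 2 := by gcongr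
      _ = c * ‖v‖⁻¹ := by field_simp
  have hk1 : ‖k‖ ≤ 1 := hkn.trans (by
    rw [← div_eq_mul_inv, div_le_one hvp]; exact hvc)
  set q : ℂ := -(1 + k) / (v * u) with hq
  have hqn : ‖q‖ ≤ 2 * ‖v‖⁻¹ * ‖u‖⁻¹ := by
    rw [hq, norm_div, norm_neg, norm_mul, div_eq_mul_inv, mul_inv, ← mul_assoc]
    gcongr
    refine (norm_add_le _ _).trans ?_
    rw [norm_one]; linarith
  have hui : ‖u‖⁻¹ ≤ 1 / 4 := by
    rw [one_div]; exact inv_anti₀ (by norm_num) (by linarith)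
  have hvi : ‖v‖⁻¹ ≤ 1 / 4 := by
    rw [one_div]; exact inv_anti₀ (by norm_num) (by linarith)
  have hvi0 : 0 ≤ ‖v‖⁻¹ := by positivity
  have hui0 : 0 ≤ ‖u‖⁻¹ := by positivity
  have hqv : ‖q‖ ≤ ‖v‖⁻¹ := hqn.trans (by nlinarith)
  have hq1 : 1 / 2 ≤ ‖1 + q‖ := by
    have := norm_sub_le (1 + q) q
    rw [add_sub_cancel_right, norm_one] at this
    linarith
  have hq0 : 1 + q ≠ 0 := by
    intro h0; rw [h0, norm_zero] at hq1; linarith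
  refine ⟨(k - q) / (1 + q), ?_, ?_⟩
  · rw [norm_div, div_le_iff₀ (by linarith)]
    have h1 : ‖k - q‖ ≤ (c + 1) * ‖v‖⁻¹ := (norm_sub_le _ _).trans (by linarith)
    have h2 : 0 ≤ (c + 1) * ‖v‖⁻¹ := (norm_nonneg _).trans h1
    nlinarith
  have key : v + (1 + (k - q) / (1 + q)) / u = v / (1 + q) := by
    have e1 : 1 + (k - q) / (1 + q) = (1 + k) / (1 + q) := by
      field_simp; ring
    have e2 : 1 + k = -(q * v * u) := by rw [hq]; field_simp
    rw [e1, e2]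
    field_simp
    ring
  rw [key]
  refine ⟨div_ne_zero hv0 hq0, ?_⟩
  have e3 : e = k / (u * v ^ 2) := by rw [hk]; field_simp
  rw [inv_div, e3, hq]
  field_simp
  ring

/-- In the coordinates `(u, v)`, the map `F` is `(u, v) ↦ (u + 1 + O(1/v), v + (1 + O(1/v))/u)` for
`|u| > |v|`. -/
theorem IsInvariantCurve.exists_step {F : ℂ × ℂ → ℂ × ℂ} {K R : ℝ} {ψ : ℂ → ℂ}
    (hψ : IsInvariantCurve F K R ψ) (h : HasBounds F K R) :
    ∃ c N : ℝ, 0 < c ∧ 8 * R ≤ N ∧ ∀ u v : ℂ, ‖u‖ ≤ 2 * u.re → N ≤ ‖v‖ → ‖v‖ < ‖u‖ →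
      ∃ a b : ℂ, ‖a‖ ≤ c * ‖v‖⁻¹ ∧ ‖b‖ ≤ c * ‖v‖⁻¹ ∧ v + (1 + b) / u ≠ 0 ∧
        F (param ψ (u, v)) = param ψ (u + 1 + a, v + (1 + b) / u) := by
  have hR := h.R_pos
  have hK := h.one_le_K
  have hRK := h.le_R
  refine ⟨2 * (50000 * K + 1), 8 * R + 50000 * K, by linarith, by linarith,
    fun u v hc hN huv => ?_⟩
  have hvp : 0 < ‖v‖ := by linarith
  have hup : 0 < ‖u‖ := by linarith
  have hv0 : v ≠ 0 := norm_pos_iff.1 hvp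
  have hu0 : u ≠ 0 := norm_pos_iff.1 hup
  set η : ℝ := ‖v‖⁻¹ with hη
  set r : ℝ := ‖u‖⁻¹ with hr
  have hη0 : 0 < η := by positivity
  have hr0 : 0 < r := by positivity
  have hrη : r ≤ η := inv_anti₀ hvp huv.le
  have hηR : η ≤ 1 / (8 * R) := by
    rw [one_div]; exact inv_anti₀ (by linarith) (by linarith)
  have hR8 : 1 / (8 * R) = 1 / 8 * (1 / R) := by field_simp
  have hKη : K * η ≤ 1 / 8000 := by
    have : K * η ≤ K * (1 / (8 * R)) := by gcongr
    refine this.trans ?_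
    rw [mul_one_div, div_le_div_iff₀ (by linarith) (by norm_num)]
    linarith
  have hKr : K * r ≤ 1 / 8000 := (mul_le_mul_of_nonneg_left hrη (by linarith)).trans hKη
  have hη1 : η ≤ 1 / 8000 := by nlinarith
  have hr1 : r ≤ 1 / 8000 := hrη.trans hη1
  have hre : 4 * R < u.re := by linarith
  have hre0 : 0 < u.re := by linarith
  have hψb : ‖ψ u‖ ≤ 288 * K * r ^ 3 := hψ.norm_le_of_abs_im_le h (by linarith) hc
  have hψη : ‖ψ u‖ ≤ η := by
    refine hψb.trans ?_
    calc 288 * K * r ^ 3 = 288 * (K * r) * r * r := by ring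
      _ ≤ 288 * (1 / 8000) * 1 * η := by gcongr; linarith
      _ ≤ η := by linarith
  set y : ℂ := -v⁻¹ with hy
  have hyn : ‖y‖ = η := by rw [hy, norm_neg, norm_inv]
  set w : ℂ := y + ψ u with hw
  have hwn : ‖w‖ ≤ 2 * η := (norm_add_le _ _).trans (by linarith)
  have hRpos' : 0 < 1 / R := by positivity
  have hwR : ‖w‖ ≤ 1 / R := by linarith
  have hψR : ‖ψ u‖ ≤ 1 / R := by linarith
  have huR : R ≤ ‖u‖ := by linarith
  set a : ℂ := drift F (u, w) with ha
  set a₀ : ℂ := drift F (u, ψ u) with ha₀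
  have han : ‖a‖ ≤ 3 * (K * η) := by
    refine (h.drift_le u w huR hwR).trans ?_
    calc K * (r + ‖w‖) ≤ K * (η + 2 * η) := by gcongr
      _ = _ := by ring
  have ha₀n : ‖a₀‖ ≤ 2 * (K * η) := by
    refine (h.drift_le u _ huR hψR).trans ?_
    calc K * (r + ‖ψ u‖) ≤ K * (η + η) := by gcongr
      _ = _ := by ring
  have hre_a : u.re ≤ (u + 1 + a).re := by
    have := (abs_le.1 (Complex.abs_re_le_norm a)).1
    simp only [Complex.add_re, Complex.one_re]; linarith
  have hre_a₀ : u.re ≤ (u + 1 + a₀).re := by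
    have := (abs_le.1 (Complex.abs_re_le_norm a₀)).1
    simp only [Complex.add_re, Complex.one_re]; linarith
  have hdiff : ‖ψ (u + 1 + a) - ψ (u + 1 + a₀)‖ ≤ 46080 * K * (r * η ^ 3) := by
    have hconv : Convex ℝ {x : ℂ | u.re ≤ x.re} := convex_halfSpace_re_ge u.re
    have hb := hconv.norm_image_sub_le_of_norm_deriv_le (𝕜 := ℂ) (f := ψ)
      (C := 576 * K / u.re ^ 4)
      (fun x (hx : u.re ≤ x.re) => hψ.differentiableAt (by linarith))
      (fun x (hx : u.re ≤ x.re) => (hψ.norm_deriv_le h (by linarith)).trans (by gcongr))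
      hre_a₀ hre_a
    refine hb.trans ?_
    have h1 : 576 * K / u.re ^ 4 ≤ 9216 * K * r ^ 4 := by
      calc 576 * K / u.re ^ 4 ≤ 576 * K / (‖u‖ / 2) ^ 4 := by gcongr; linarith
        _ = 9216 * K * r ^ 4 := by rw [hr]; field_simp; ring
    have h2 : ‖u + 1 + a - (u + 1 + a₀)‖ ≤ 5 * (K * η) := by
      rw [add_sub_add_left_eq_sub]
      exact (norm_sub_le _ _).trans (by linarith)
    calc _ ≤ 9216 * K * r ^ 4 * (5 * (K * η)) := by gcongr
      _ = 46080 * K * ((K * r) * r * r ^ 2 * η) := by ring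
      _ ≤ 46080 * K * (1 * r * η ^ 2 * η) := by gcongr; linarith
      _ = _ := by ring
  have hs1 : ‖shear F (u, w) - w ^ 2 / u‖ ≤ 27 * K * (r * η ^ 3) := by
    refine (h.shear_le u w huR hwR).trans ?_
    calc K * (r * (r + ‖w‖) ^ 3) ≤ K * (r * (η + 2 * η) ^ 3) := by gcongr
      _ = _ := by ring
  have hs2 : ‖shear F (u, ψ u) - ψ u ^ 2 / u‖ ≤ 8 * K * (r * η ^ 3) := by
    refine (h.shear_le u _ huR hψR).trans ?_
    calc K * (r * (r + ‖ψ u‖) ^ 3) ≤ K * (r * (η + η) ^ 3) := by gcongr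
      _ = _ := by ring
  have hs3 : ‖2 * y * ψ u / u‖ ≤ 576 * K * (r * η ^ 3) := by
    rw [norm_div, norm_mul, norm_mul, hyn, div_eq_mul_inv, Complex.norm_ofNat]
    calc 2 * η * ‖ψ u‖ * r ≤ 2 * η * (288 * K * r ^ 3) * r := by gcongr
      _ = 576 * K * (r * (η * (r ^ 2 * r))) := by ring
      _ ≤ 576 * K * (r * (η * (η ^ 2 * 1))) := by gcongr; linarith
      _ = _ := by ring
  have hinv := hψ.map_eq u (by linarith) (show 2 * R < (u + 1 + a₀).re by linarith)
  -- By invariance of the curve, e is a difference of two shear errors, plus the cross term of w² =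
  -- (y + ψ)², minus the variation of ψ between the two image points. Each is O(r η³); the constants
  -- 27, 8, 576 and 46080 add up to less than 50000.
  set e : ℂ := w + shear F (u, w) - ψ (u + 1 + a) - (y + y ^ 2 / u) with he
  have hen : ‖e‖ ≤ 50000 * K * (r * η ^ 3) := by
    have e1 : e = (shear F (u, w) - w ^ 2 / u) - (shear F (u, ψ u) - ψ u ^ 2 / u)
        + 2 * y * ψ u / u - (ψ (u + 1 + a) - ψ (u + 1 + a₀)) := by
      rw [hinv, he, hw]; field_simp; ring
    have hpos : 0 ≤ K * (r * η ^ 3) := by positivity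
    rw [e1]
    refine (norm_sub_le _ _).trans ((add_le_add ((norm_add_le _ _).trans (add_le_add
      ((norm_sub_le _ _).trans (add_le_add hs1 hs2)) hs3)) hdiff).trans ?_)
    linarith
  obtain ⟨b, hb1, hb2, hb3⟩ := exists_eq_neg_inv (u := u) (v := v) (e := e) (c := 50000 * K)
    (by linarith) (by linarith) huv.le hen
  refine ⟨a, b, han.trans ?_, hb1, hb2, ?_⟩
  · have hKη0 : 0 ≤ K * η := by positivity
    have e2 : 2 * (50000 * K + 1) * η = 100000 * (K * η) + 2 * η := by ring
    rw [e2]; linarith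
  · simp only [param]
    rw [h.apply_eq huR hwR, ← hb3]
    ext1
    · rfl
    · simp only [he]; ring

/-! ### Asymptotics of recursions -/

/-- Cesàro means of the increments. -/
theorem tendsto_div_natCast_of_tendsto_sub {u : ℕ → ℂ}
    (h : Tendsto (fun n => u (n + 1) - u n) atTop (𝓝 1)) :
    Tendsto (fun n : ℕ => u n / n) atTop (𝓝 1) := by
  have h1 := h.cesaro_smul
  have h2 : Tendsto (fun n : ℕ => u 0 * ((n : ℂ))⁻¹) atTop (𝓝 0) := by
    simpa using (tendsto_inv_atTop_nhds_zero_nat (𝕜 := ℂ)).const_mul (u 0)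
  have h3 := h1.add h2
  rw [add_zero] at h3
  refine h3.congr fun n => ?_
  rw [Finset.sum_range_sub, Complex.real_smul]
  push_cast
  ring

theorem tendsto_harmonic_div_log :
    Tendsto (fun n : ℕ => (harmonic n : ℝ) / Real.log n) atTop (𝓝 1) := by
  have hlog : Tendsto (fun n : ℕ => Real.log n) atTop atTop :=
    Real.tendsto_log_atTop.comp tendsto_natCast_atTop_atTop
  have h1 := (Real.tendsto_harmonic_sub_log.div_atTop hlog).add_const 1
  rw [zero_add] at h1
  refine h1.congr' ?_
  filter_upwards [hlog.eventually_gt_atTop 0] with n hn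
  field_simp
  ring

/-- The increments are 1/(n + 1) + o(1/(n + 1)). Since the harmonic series diverges, the errors sum
to o(harmonic), and the harmonic numbers are equivalent to log n. -/
theorem tendsto_div_log_of_tendsto_mul_sub {v : ℕ → ℂ}
    (h : Tendsto (fun n : ℕ => ((n : ℂ) + 1) * (v (n + 1) - v n)) atTop (𝓝 1)) :
    Tendsto (fun n : ℕ => v n / (Real.log n : ℂ)) atTop (𝓝 1) := by
  have hlog : Tendsto (fun n : ℕ => Real.log n) atTop atTop :=
    Real.tendsto_log_atTop.comp tendsto_natCast_atTop_atTop
  have hH : ∀ n : ℕ, ∑ i ∈ Finset.range n, (1 / ((i : ℝ) + 1)) = (harmonic n : ℝ) := by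
    intro n
    simp [harmonic]
  have hlo : (fun n : ℕ => (v (n + 1) - v n) - 1 / ((n : ℂ) + 1)) =o[atTop]
      fun n : ℕ => 1 / ((n : ℝ) + 1) := by
    rw [isLittleO_iff]
    intro c hc
    filter_upwards [Metric.tendsto_nhds.1 h c hc] with n hn
    rw [dist_eq_norm] at hn
    have hn0 : (n : ℂ) + 1 ≠ 0 := Nat.cast_add_one_ne_zero n
    have e : (v (n + 1) - v n) - 1 / ((n : ℂ) + 1) =
        (((n : ℂ) + 1) * (v (n + 1) - v n) - 1) * (((1 / ((n : ℝ) + 1) : ℝ)) : ℂ) := by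
      push_cast
      field_simp
    rw [e, norm_mul, Complex.norm_real]
    gcongr
  have hsum := hlo.sum_range (fun n => by positivity) Real.tendsto_sum_range_one_div_nat_succ_atTop
  simp only [hH, Finset.sum_sub_distrib] at hsum
  have hHO : (fun n : ℕ => (harmonic n : ℝ)) =O[atTop] fun n : ℕ => Real.log n :=
    (isEquivalent_of_tendsto_one tendsto_harmonic_div_log).isBigO
  have h1 := ((hsum.trans_isBigO hHO).trans_isTheta
    (Complex.isTheta_ofReal (fun n : ℕ => Real.log n) atTop).symm).tendsto_div_nhds_zero
  have h2 : Tendsto (fun n : ℕ => v 0 / (Real.log n : ℂ)) atTop (𝓝 0) := by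
    rw [tendsto_zero_iff_norm_tendsto_zero]
    simp only [norm_div, Complex.norm_real]
    exact tendsto_const_nhds.div_atTop (tendsto_norm_atTop_atTop.comp hlog)
  have h3 : Tendsto (fun n : ℕ => (((harmonic n : ℝ) / Real.log n : ℝ) : ℂ)) atTop (𝓝 1) := by
    have := (Complex.continuous_ofReal.tendsto 1).comp tendsto_harmonic_div_log
    simpa only [Function.comp_def, Complex.ofReal_one] using this
  have h4 := (h1.add h2).add h3
  rw [add_zero, zero_add] at h4
  refine h4.congr fun n => ?_
  have e : ∑ i ∈ Finset.range n, (1 / ((i : ℂ) + 1)) = ((harmonic n : ℝ) : ℂ) := by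
    rw [← hH]; push_cast; rfl
  have e' := Finset.sum_range_sub v n
  rw [Finset.sum_sub_distrib] at e'
  rw [e, e', Complex.ofReal_div]
  ring

/-! ### The dynamics in the coordinates `(u, v)` -/

/-- The region in the coordinates `u = -1/z`, `v = -1/(w - γ(z))`. -/
def chart (t s N : ℝ) : Set (ℂ × ℂ) :=
  {q | |q.1.im| < t * q.1.re ∧ |q.2.im| < s * q.2.re ∧ N < ‖q.2‖ ∧ ‖q.2‖ < ‖q.1‖}

/-- Moving a point `v` of a sector by approximately `1/u`, with `u` in a narrower sector. -/
theorem add_div_mem_cone {t s δ : ℝ} (ht0 : 0 < t) (ht : t ≤ 1) (hs : 0 < s) (hδ : 0 ≤ δ)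
    (hδ4 : δ ≤ 1 / 4) (h1 : t + 2 * δ ≤ s * (1 - 2 * δ)) (h2 : s * (t + 2 * δ) ≤ 1 - 2 * δ)
    {u v b : ℂ} (hu : |u.im| < t * u.re) (hv : |v.im| < s * v.re) (hb : ‖b‖ ≤ δ) :
    |(v + (1 + b) / u).im| < s * (v + (1 + b) / u).re ∧ ‖v‖ < ‖v + (1 + b) / u‖ ∧
      v.re + 1 / (4 * ‖u‖) ≤ (v + (1 + b) / u).re ∧ ‖(1 + b) / u‖ ≤ 2 / ‖u‖ := by
  have hu' := abs_im_inv_lt_iff.2 hu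
  set c : ℝ := u⁻¹.re with hc
  have hn := norm_le_two_mul_re ht0 ht hu'.le
  have hc0 : 0 < c := pos_of_mul_pos_right ((abs_nonneg _).trans_lt hu') ht0.le
  have hv0 : 0 < v.re := pos_of_mul_pos_right ((abs_nonneg _).trans_lt hv) hs.le
  have hbu : ‖b * u⁻¹‖ ≤ 2 * δ * c := by
    rw [norm_mul]
    calc ‖b‖ * ‖u⁻¹‖ ≤ δ * (2 * c) := by gcongr
      _ = _ := by ring
  set x : ℂ := (1 + b) / u with hx
  have hx' : x = u⁻¹ + b * u⁻¹ := by rw [hx, div_eq_mul_inv]; ring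
  have hxre : (1 - 2 * δ) * c ≤ x.re := by
    have := (abs_le.1 ((Complex.abs_re_le_norm _).trans hbu)).1
    rw [hx', Complex.add_re]; linarith
  have hxim : |x.im| < (t + 2 * δ) * c := by
    have := (Complex.abs_im_le_norm _).trans hbu
    rw [hx', Complex.add_im]
    exact (abs_add_le _ _).trans_lt (by linarith)
  have hxc : c / 2 ≤ x.re := by nlinarith
  refine ⟨?_, ?_, ?_, ?_⟩
  · rw [Complex.add_im, Complex.add_re]
    refine (abs_add_le _ _).trans_lt ?_
    have e1 : (t + 2 * δ) * c ≤ s * (1 - 2 * δ) * c := by gcongr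
    have e2 : s * ((1 - 2 * δ) * c) ≤ s * x.re := by gcongr
    linarith
  · refine lt_of_pow_lt_pow_left₀ 2 (norm_nonneg _) ?_
    rw [Complex.sq_norm, Complex.sq_norm, Complex.normSq_apply, Complex.normSq_apply,
      Complex.add_re, Complex.add_im]
    -- The real inner product of v and x is nonnegative: this is where s(t + 2δ) ≤ 1 - 2δ is used,
    -- the perturbed form of the two cone angles adding up to less than π/2.
    have e1 : |v.im * x.im| ≤ v.re * x.re := by
      rw [abs_mul]
      calc |v.im| * |x.im| ≤ s * v.re * ((t + 2 * δ) * c) := by gcongr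
        _ = v.re * (s * (t + 2 * δ) * c) := by ring
        _ ≤ v.re * ((1 - 2 * δ) * c) := by gcongr
        _ ≤ v.re * x.re := by gcongr
    have e2 := (abs_le.1 e1).1
    have e3 : 0 < x.re := by linarith
    nlinarith [mul_self_nonneg x.im, mul_pos e3 e3]
  · rw [Complex.add_re]
    rw [norm_inv] at hn
    have : 1 / (4 * ‖u‖) = ‖u‖⁻¹ / 4 := by rw [one_div, mul_inv]; ring
    linarith
  · rw [hx, norm_div]
    gcongr
    refine (norm_add_le _ _).trans ?_
    rw [norm_one]; linarith

/-- The quantitative form of one step of `F` in the coordinates `(u, v)`. -/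
structure ChartStep (F : ℂ × ℂ → ℂ × ℂ) (ψ : ℂ → ℂ) (c : ℝ) (q q' : ℂ × ℂ) : Prop where
  map_eq : F (param ψ q) = param ψ q'
  norm_fst_sub_le : ‖q'.1 - q.1 - 1‖ ≤ c * ‖q.2‖⁻¹
  norm_fst_sub_le_one : ‖q'.1 - q.1 - 1‖ ≤ 1
  norm_snd_sub_le : ‖q.1 * (q'.2 - q.2) - 1‖ ≤ c * ‖q.2‖⁻¹
  re_fst_le : q.1.re + 1 / 2 ≤ q'.1.re
  re_snd_le : q.2.re + 1 / (4 * ‖q.1‖) ≤ q'.2.re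

/-- The strict inequalities t < s and ts < 1 leave room for a perturbation; both final conditions
are upper bounds on 2δ(1 + s). The bound δ ≤ t/2 serves the cone of u. -/
theorem exists_cone_margin {t s : ℝ} (ht0 : 0 < t) (hts : t < s) (hts1 : t * s < 1) :
    ∃ δ : ℝ, 0 < δ ∧ δ ≤ 1 / 4 ∧ δ ≤ t / 2 ∧ t + 2 * δ ≤ s * (1 - 2 * δ) ∧
      s * (t + 2 * δ) ≤ 1 - 2 * δ := by
  have h1 : 0 < (s - t) / (2 * (1 + s)) := div_pos (by linarith) (by linarith)
  have h2 : 0 < (1 - t * s) / (2 * (1 + s)) := div_pos (by linarith) (by linarith)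
  refine ⟨min (min (1 / 4) (t / 2)) (min ((s - t) / (2 * (1 + s)))
    ((1 - t * s) / (2 * (1 + s)))), lt_min (lt_min (by norm_num) (by linarith)) (lt_min h1 h2),
    ?_, ?_, ?_, ?_⟩
  · exact (min_le_left _ _).trans (min_le_left _ _)
  · exact (min_le_left _ _).trans (min_le_right _ _)
  · have := (le_div_iff₀ (by linarith)).1
      ((min_le_right (min (1 / 4) (t / 2)) _).trans
        (min_le_left ((s - t) / (2 * (1 + s))) ((1 - t * s) / (2 * (1 + s)))))
    linarith
  · have := (le_div_iff₀ (by linarith)).1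
      ((min_le_right (min (1 / 4) (t / 2)) _).trans
        (min_le_right ((s - t) / (2 * (1 + s))) ((1 - t * s) / (2 * (1 + s)))))
    linarith

theorem IsInvariantCurve.exists_chartStep {F : ℂ × ℂ → ℂ × ℂ} {K R : ℝ} {ψ : ℂ → ℂ}
    (hψ : IsInvariantCurve F K R ψ) (h : HasBounds F K R) {t s : ℝ} (ht0 : 0 < t) (ht : t ≤ 1)
    (hts : t < s) (hts1 : t * s < 1) :
    ∃ c N₀ : ℝ, 8 * R ≤ N₀ ∧ ∀ N, N₀ ≤ N → ∀ q ∈ chart t s N,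
      ∃ q' ∈ chart t s N, ChartStep F ψ c q q' := by
  obtain ⟨c, N₁, hc, hN₁, hstep⟩ := hψ.exists_step h
  have hR := h.R_pos
  have hK := h.one_le_K
  have hRK := h.le_R
  have hs : 0 < s := ht0.trans hts
  obtain ⟨δ, hδ0, hδ4, hδt, hδ1, hδ2⟩ := exists_cone_margin ht0 hts hts1
  refine ⟨c, max N₁ (c / δ), hN₁.trans (le_max_left _ _), ?_⟩
  rintro N hN ⟨u, v⟩ ⟨hu, hv, hNv, hvu⟩
  simp only at hu hv hNv hvu
  have hN1 : N₁ ≤ ‖v‖ := (le_max_left _ _).trans (hN.trans hNv.le)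
  have hNδ : c / δ ≤ ‖v‖ := (le_max_right _ _).trans (hN.trans hNv.le)
  have hvp : 0 < ‖v‖ := by linarith
  have hup : 0 < ‖u‖ := by linarith
  have hu0 : u ≠ 0 := norm_pos_iff.1 hup
  have hcδ : c * ‖v‖⁻¹ ≤ δ := by
    rw [div_le_iff₀ hδ0] at hNδ
    rw [← div_eq_mul_inv, div_le_iff₀ hvp]
    linarith
  have hu2 := norm_le_two_mul_re ht0 ht hu.le
  obtain ⟨a, b, ha, hb, -, hF⟩ := hstep u v hu2 hN1 hvu
  obtain ⟨h1, h2, h3, h4⟩ := add_div_mem_cone ht0 ht hs hδ0.le hδ4 hδ1 hδ2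
    hu hv (hb.trans hcδ)
  have h5 := norm_add_one_add_ge (a := a) hu2
  -- |v| gains less than 1/4 while |u| gains at least 1/2 - δ ≥ 1/4, so |v| < |u| persists.
  have h6 : 2 / ‖u‖ < 1 / 4 := by
    rw [div_lt_div_iff₀ hup (by norm_num)]; linarith
  have h7 := (abs_le.1 (Complex.abs_re_le_norm a)).1
  have e1 : u + 1 + a - u - 1 = a := by ring
  have e2 : u * (v + (1 + b) / u - v) - 1 = b := by field_simp; ring
  have h8 := norm_add_le v ((1 + b) / u)
  have hmem : (u + 1 + a, v + (1 + b) / u) ∈ chart t s N :=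
    ⟨abs_im_add_one_add_lt ht (by linarith) hu, h1, hNv.trans h2,
      show ‖v + (1 + b) / u‖ < ‖u + 1 + a‖ by linarith⟩
  refine ⟨_, hmem, ?_⟩
  constructor
  · exact hF
  · rw [e1]; exact ha
  · rw [e1]; linarith
  · rw [e2]; exact hb
  · simp only [Complex.add_re, Complex.one_re]; linarith
  · exact h3

theorem exists_orbit {F : ℂ × ℂ → ℂ × ℂ} {ψ : ℂ → ℂ} {t s c N : ℝ} (hs : 0 < s)
    (hN : 0 ≤ N)
    (hstep : ∀ q ∈ chart t s N, ∃ q' ∈ chart t s N, ChartStep F ψ c q q') {q : ℂ × ℂ}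
    (hq : q ∈ chart t s N) :
    ∃ Q : ℕ → ℂ × ℂ, (∀ n, Q n ∈ chart t s N) ∧ (∀ n, F^[n] (param ψ q) = param ψ (Q n)) ∧
      Tendsto (fun n : ℕ => (Q n).1 / n) atTop (𝓝 1) ∧
      Tendsto (fun n : ℕ => (Q n).2 / (Real.log n : ℂ)) atTop (𝓝 1) := by
  choose! G hG hGs using hstep
  obtain ⟨Q, hQ, hQs⟩ : ∃ Q : ℕ → ℂ × ℂ, Q 0 = q ∧ ∀ n, Q (n + 1) = G (Q n) :=
    ⟨fun n => G^[n] q, rfl, fun n => Function.iterate_succ_apply' G n q⟩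
  have hmem : ∀ n, Q n ∈ chart t s N := by
    intro n
    induction n with
    | zero => rwa [hQ]
    | succ n ih => rw [hQs]; exact hG _ ih
  have hst : ∀ n, ChartStep F ψ c (Q n) (Q (n + 1)) := fun n => by
    rw [hQs]; exact hGs _ (hmem n)
  have hnorm : ∀ n, 0 < ‖(Q n).2‖ ∧ 0 < ‖(Q n).1‖ := fun n =>
    ⟨hN.trans_lt (hmem n).2.2.1, (hN.trans_lt (hmem n).2.2.1).trans (hmem n).2.2.2⟩
  have hup : ∀ n : ℕ, ‖(Q n).1‖ ≤ ‖q.1‖ + 2 * n := by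
    intro n
    induction n with
    | zero => simp [hQ]
    | succ n ih =>
      have e : (Q (n + 1)).1 = (Q n).1 + 1 + ((Q (n + 1)).1 - (Q n).1 - 1) := by ring
      rw [e]
      refine (norm_add_le _ _).trans ((add_le_add (norm_add_le _ _)
        (hst n).norm_fst_sub_le_one).trans ?_)
      rw [norm_one]; push_cast; linarith
  -- Since |u_n| ≤ |u_0| + 2n ≤ (|u_0| + 2)(n + 1), the gain 1/(4|u_n|) of Re v_n is at least 1/(B(n
  -- + 1)), and the harmonic series diverges.
  set B : ℝ := 4 * (‖q.1‖ + 2) with hB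
  have hB0 : 0 < B := by positivity
  have hvre : ∀ n : ℕ, 1 / B * ∑ k ∈ Finset.range n, (1 / ((k : ℝ) + 1)) ≤ (Q n).2.re := by
    intro n
    induction n with
    | zero =>
      simpa [hQ] using (pos_of_mul_pos_right ((abs_nonneg _).trans_lt hq.2.1) hs.le).le
    | succ n ih =>
      rw [Finset.sum_range_succ, mul_add]
      refine (add_le_add ih ?_).trans (hst n).re_snd_le
      rw [one_div_mul_one_div]
      have hn : (0 : ℝ) ≤ n := Nat.cast_nonneg n
      refine one_div_le_one_div_of_le (by linarith [(hnorm n).2]) ?_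
      rw [hB]
      nlinarith [hup n, norm_nonneg q.1]
  have hretop : Tendsto (fun n => (Q n).2.re) atTop atTop :=
    tendsto_atTop_mono hvre
      (Real.tendsto_sum_range_one_div_nat_succ_atTop.const_mul_atTop (by positivity))
  -- Once v_n → ∞, all step errors tend to 0: the increments of u tend to 1 and u_n(v_{n+1} - v_n) →
  -- 1.
  have hinv : Tendsto (fun n => c * ‖(Q n).2‖⁻¹) atTop (𝓝 0) := by
    have := (tendsto_inv_atTop_zero.comp
      (tendsto_atTop_mono (fun n => Complex.re_le_norm (Q n).2) hretop)).const_mul c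
    simpa using this
  have hu1 : Tendsto (fun n => (Q (n + 1)).1 - (Q n).1) atTop (𝓝 1) := by
    exact tendsto_iff_norm_sub_tendsto_zero.2
      (squeeze_zero (fun _ => norm_nonneg _) (fun n => (hst n).norm_fst_sub_le) hinv)
  have hu := tendsto_div_natCast_of_tendsto_sub (u := fun n => (Q n).1) hu1
  have hv1 : Tendsto (fun n => (Q n).1 * ((Q (n + 1)).2 - (Q n).2)) atTop (𝓝 1) := by
    exact tendsto_iff_norm_sub_tendsto_zero.2
      (squeeze_zero (fun _ => norm_nonneg _) (fun n => (hst n).norm_snd_sub_le) hinv)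
  refine ⟨Q, hmem, fun n => ?_, hu, tendsto_div_log_of_tendsto_mul_sub (v := fun n => (Q n).2) ?_⟩
  · induction n with
    | zero => rw [hQ]; rfl
    | succ n ih => rw [Function.iterate_succ_apply', ih, (hst n).map_eq]
  · have h1 : Tendsto (fun n : ℕ => (Q n).1 / ((n : ℂ) + 1)) atTop (𝓝 1) := by
      have := hu.mul (tendsto_natCast_div_add_atTop (1 : ℂ))
      rw [mul_one] at this
      refine this.congr' ?_
      filter_upwards [eventually_ne_atTop 0] with n hn
      have hn' : (n : ℂ) ≠ 0 := Nat.cast_ne_zero.2 hn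
      have hn1 : (n : ℂ) + 1 ≠ 0 := Nat.cast_add_one_ne_zero n
      field_simp
    have h2 := (h1.inv₀ one_ne_zero).mul hv1
    rw [inv_one, mul_one] at h2
    refine h2.congr fun n => ?_
    have := norm_pos_iff.1 (hnorm n).2
    rw [inv_div]
    field_simp

/-- Inversion preserves the cones and reverses the size inequalities. The condition |z| < ε has no
counterpart in `chart` because |u| > |v| > 1/ε implies it. -/
theorem param_mem_region_iff {ψ : ℂ → ℂ} {ε α θ : ℝ} (hε : 0 < ε) (hα0 : 0 < α)
    (hα : α < Real.pi / 2) (hθ0 : 0 < θ) (hθ : θ < Real.pi / 2) (q : ℂ × ℂ) :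
    param ψ q ∈ region (fun z => ψ (-z⁻¹)) ε α θ ↔
      q ∈ chart (Real.tan α) (Real.tan θ) (1 / ε) := by
  obtain ⟨u, v⟩ := q
  have e : ∀ x : ℂ, -(-x⁻¹)⁻¹ = x := fun x => by rw [inv_neg, inv_inv, neg_neg]
  have hcone : ∀ {x : ℂ} {t : ℝ}, |x.im| < t * x.re → 0 < ‖x‖ := by
    intro x t hx
    refine norm_pos_iff.2 fun h0 => ?_
    simp [h0] at hx
  have key : ∀ x : ℂ, 0 < ‖x‖ → (‖x‖⁻¹ < ε ↔ 1 / ε < ‖x‖) := by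
    intro x hx
    rw [one_div, inv_lt_comm₀ hx hε]
  simp only [region, param, chart, Set.mem_ofPred_eq, e, add_sub_cancel_right,
    mem_sector_iff_inv hα0 hα, mem_sector_iff_inv hθ0 hθ, norm_neg, norm_inv]
  constructor
  · rintro ⟨⟨h1, h2⟩, ⟨h3, h4⟩, h5⟩
    exact ⟨h2, h4, (key v (hcone h4)).1 h3, (inv_lt_inv₀ (hcone h2) (hcone h4)).1 h5⟩
  · rintro ⟨h1, h2, h3, h4⟩
    have hv := hcone h2
    have hu := hcone h1
    exact ⟨⟨(key u hu).2 (h3.trans h4), h1⟩, ⟨(key v hv).2 h3, h2⟩, (inv_lt_inv₀ hu hv).2 h4⟩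

theorem param_coordinates (ψ : ℂ → ℂ) (p : ℂ × ℂ) :
    param ψ (-p.1⁻¹, -(p.2 - ψ (-p.1⁻¹))⁻¹) = p := by
  simp [param]

/-- The asymptotics of an orbit, in terms of its coordinates `(u, v)`. -/
theorem IsInvariantCurve.asymptotics {F : ℂ × ℂ → ℂ × ℂ} {K R : ℝ} {ψ : ℂ → ℂ}
    (hψ : IsInvariantCurve F K R ψ) (h : HasBounds F K R) {t s N : ℝ} (ht0 : 0 < t) (ht : t ≤ 1)
    (hN : 8 * R ≤ N) {p : ℂ × ℂ} {Q : ℕ → ℂ × ℂ} (hQ : ∀ n, Q n ∈ chart t s N)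
    (hF : ∀ n, F^[n] p = param ψ (Q n))
    (hu : Tendsto (fun n : ℕ => (Q n).1 / n) atTop (𝓝 1))
    (hv : Tendsto (fun n : ℕ => (Q n).2 / (Real.log n : ℂ)) atTop (𝓝 1)) :
    (fun n : ℕ => ‖(F^[n] p).1‖) ~[atTop] (fun n : ℕ => 1 / (n : ℝ)) ∧
    (fun n : ℕ => ‖(F^[n] p).2‖) ~[atTop] (fun n : ℕ => 1 / Real.log (n : ℝ)) ∧
    AttractedAlong F (0, 1) p := by
  have hR := h.R_pos
  have hK := h.one_le_K
  have hlog : Tendsto (fun n : ℕ => Real.log n) atTop atTop :=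
    Real.tendsto_log_atTop.comp tendsto_natCast_atTop_atTop
  have hQpos : ∀ n, 8 * R < ‖(Q n).2‖ ∧ 8 * R < ‖(Q n).1‖ := fun n =>
    ⟨by linarith [(hQ n).2.2.1], by linarith [(hQ n).2.2.1, (hQ n).2.2.2]⟩
  have hne1 : ∀ n, (Q n).1 ≠ 0 := fun n => norm_pos_iff.1 (by linarith [(hQpos n).2])
  have hne2 : ∀ n, (Q n).2 ≠ 0 := fun n => norm_pos_iff.1 (by linarith [(hQpos n).1])
  have hψb : ∀ n, ‖ψ (Q n).1‖ ≤ 288 * K * ‖(Q n).1‖⁻¹ ^ 3 := by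
    intro n
    have := norm_le_two_mul_re ht0 ht (hQ n).1.le
    exact hψ.norm_le_of_abs_im_le h (by linarith [(hQpos n).2]) this
  have hnu : Tendsto (fun n : ℕ => (n : ℂ) / (Q n).1) atTop (𝓝 1) := by
    simpa using hu.inv₀ one_ne_zero
  have hlv : Tendsto (fun n : ℕ => (Real.log n : ℂ) / (Q n).2) atTop (𝓝 1) := by
    simpa only [inv_div, inv_one] using hv.inv₀ one_ne_zero
  have hninv : Tendsto (fun n : ℕ => ((n : ℂ))⁻¹) atTop (𝓝 0) := tendsto_inv_atTop_nhds_zero_nat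
  have hlinv : Tendsto (fun n : ℕ => ((Real.log n : ℝ) : ℂ)⁻¹) atTop (𝓝 0) := by
    rw [tendsto_zero_iff_norm_tendsto_zero]
    simp only [norm_inv, Complex.norm_real]
    exact tendsto_inv_atTop_zero.comp (tendsto_norm_atTop_atTop.comp hlog)
  have hln : Tendsto (fun n : ℕ => ((Real.log n : ℝ) : ℂ) * ((n : ℂ))⁻¹) atTop (𝓝 0) := by
    have h1 := (Real.isLittleO_log_id_atTop.comp_tendsto
      (tendsto_natCast_atTop_atTop (R := ℝ))).tendsto_div_nhds_zero
    have h2 := (Complex.continuous_ofReal.tendsto 0).comp h1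
    rw [Complex.ofReal_zero] at h2
    refine h2.congr fun n => ?_
    simp [div_eq_mul_inv]
  have hlog0 : ∀ᶠ n : ℕ in atTop, ((Real.log n : ℝ) : ℂ) ≠ 0 := by
    filter_upwards [hlog.eventually_gt_atTop 0] with n hn
    exact Complex.ofReal_ne_zero.2 hn.ne'
  have hn0 : ∀ᶠ n : ℕ in atTop, (n : ℂ) ≠ 0 := by
    filter_upwards [eventually_ne_atTop 0] with n hn
    exact Nat.cast_ne_zero.2 hn
  have huinv : Tendsto (fun n => ((Q n).1)⁻¹) atTop (𝓝 0) := by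
    have := hninv.mul hnu
    rw [zero_mul] at this
    refine this.congr' ?_
    filter_upwards [hn0] with n hn
    field_simp
  have hvinv : Tendsto (fun n => ((Q n).2)⁻¹) atTop (𝓝 0) := by
    have := hlinv.mul hlv
    rw [zero_mul] at this
    refine this.congr' ?_
    filter_upwards [hlog0] with n hn
    field_simp
  have huinvn : Tendsto (fun n => ‖(Q n).1‖⁻¹) atTop (𝓝 0) := by
    simpa using huinv.norm
  have hψ0 : Tendsto (fun n => ψ (Q n).1) atTop (𝓝 0) := by
    refine squeeze_zero_norm hψb ?_
    simpa using (huinvn.pow 3).const_mul (288 * K)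
  have hψu : Tendsto (fun n => (Q n).1 * ψ (Q n).1) atTop (𝓝 0) := by
    refine squeeze_zero_norm (a := fun n => 288 * K * ‖(Q n).1‖⁻¹ ^ 2) (fun n => ?_) ?_
    · rw [norm_mul]
      have hp : 0 < ‖(Q n).1‖ := norm_pos_iff.2 (hne1 n)
      calc _ ≤ ‖(Q n).1‖ * (288 * K * ‖(Q n).1‖⁻¹ ^ 3) := by gcongr; exact hψb n
        _ = _ := by field_simp
    · simpa using (huinvn.pow 2).const_mul (288 * K)
  have hvu : Tendsto (fun n => (Q n).2 / (Q n).1) atTop (𝓝 0) := by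
    have := (hv.mul hln).mul hnu
    rw [mul_zero, zero_mul] at this
    refine this.congr' ?_
    filter_upwards [hlog0, hn0] with n h1 h2
    have := hne1 n
    field_simp
  refine ⟨?_, ?_, ?_, ?_, ?_⟩
  · refine isEquivalent_of_tendsto_one ?_
    have := hnu.norm
    rw [norm_one] at this
    refine this.congr fun n => ?_
    simp only [Pi.div_apply, hF, param, norm_neg, norm_inv, norm_div, Complex.norm_natCast]
    rw [div_div_eq_mul_div, div_one, mul_comm, div_eq_mul_inv]
  · refine isEquivalent_of_tendsto_one ?_
    have hψl : Tendsto (fun n : ℕ => (Real.log n : ℂ) * ψ (Q n).1) atTop (𝓝 0) := by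
      have := (hln.mul hnu).mul hψu
      rw [zero_mul, zero_mul] at this
      refine this.congr' ?_
      filter_upwards [hn0] with n h2
      have := hne1 n
      field_simp
    have := (hlv.neg.add hψl).norm
    rw [add_zero, norm_neg, norm_one] at this
    refine this.congr' ?_
    filter_upwards [hlog.eventually_gt_atTop 0] with n hn
    simp only [Pi.div_apply, hF, param]
    have e : -((Real.log n : ℂ) / (Q n).2) + (Real.log n : ℂ) * ψ (Q n).1 =
        (Real.log n : ℂ) * (-((Q n).2)⁻¹ + ψ (Q n).1) := by ring
    rw [e, norm_mul, Complex.norm_real, Real.norm_of_nonneg hn.le, div_div_eq_mul_div, div_one,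
      mul_comm]
  · simp only [hF, param]
    rw [Prod.zero_eq_mk]
    refine Tendsto.prodMk_nhds ?_ ?_
    · simpa using huinv.neg
    · simpa using hvinv.neg.add hψ0
  · refine Eventually.of_forall fun n h0 => ?_
    rw [hF] at h0
    have := congrArg Prod.fst h0
    simp [param, hne1 n] at this
  -- Rescaling by -v turns (-1/u, -1/v + ψ) into (v/u, 1 - vψ), where v/u → 0 and uψ → 0.
  · refine ⟨fun n => -(Q n).2, ?_⟩
    simp only [hF, param, Prod.smul_mk, smul_eq_mul]
    refine Tendsto.prodMk_nhds ?_ ?_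
    · refine hvu.congr fun n => ?_
      ring
    · have := (hvu.mul hψu).const_sub 1
      rw [mul_zero, sub_zero] at this
      refine this.congr fun n => ?_
      have := hne1 n
      have := hne2 n
      field_simp
      ring

/-- This is the use of θ < 3π/8: with α ≤ π/8 it keeps v and 1/u at an acute angle. -/
theorem tan_mul_tan_lt_one {α θ : ℝ} (hα0 : 0 < α) (hθ0 : 0 < θ) (h : α + θ < Real.pi / 2) :
    Real.tan α * Real.tan θ < 1 := by
  have hα : 0 < Real.tan α := Real.tan_pos_of_pos_of_lt_pi_div_two hα0 (by linarith)
  have h1 : Real.tan θ < Real.tan (Real.pi / 2 - α) :=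
    Real.tan_lt_tan_of_lt_of_lt_pi_div_two (by linarith) (by linarith) (by linarith)
  rw [Real.tan_pi_div_two_sub, ← one_div, lt_div_iff₀ hα] at h1
  linarith

/-- Orbits that are asymptotically real enter every sector. -/
theorem eventually_abs_im_lt {v : ℕ → ℂ} {s : ℝ} (hs : 0 < s)
    (hv : Tendsto (fun n : ℕ => v n / (Real.log n : ℂ)) atTop (𝓝 1)) :
    ∀ᶠ n in atTop, |(v n).im| < s * (v n).re := by
  have hlog : Tendsto (fun n : ℕ => Real.log n) atTop atTop :=
    Real.tendsto_log_atTop.comp tendsto_natCast_atTop_atTop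
  have hopen : IsOpen {x : ℂ | |x.im| < s * x.re} :=
    isOpen_lt Complex.continuous_im.abs (continuous_const.mul Complex.continuous_re)
  filter_upwards [hv.eventually (hopen.mem_nhds (show |(1 : ℂ).im| < s * (1 : ℂ).re by simpa)),
    hlog.eventually_gt_atTop 0] with n hn hl
  rw [Complex.div_ofReal_im, Complex.div_ofReal_re, abs_div, abs_of_pos hl,
    ← mul_div_assoc, div_lt_div_iff_of_pos_right hl] at hn
  exact hn

/-- Invariance of the region with half-openings `α < θ`, and the behaviour of its orbits. -/
theorem IsInvariantCurve.exists_region_dynamics {F : ℂ × ℂ → ℂ × ℂ} {K R : ℝ} {ψ : ℂ → ℂ}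
    (hψ : IsInvariantCurve F K R ψ) (h : HasBounds F K R) {α θ : ℝ} (hα0 : 0 < α)
    (hα : α ≤ Real.pi / 8) (hαθ : α < θ) (hθ : θ < 3 * Real.pi / 8) :
    ∃ ε₀ : ℝ, 0 < ε₀ ∧ ∀ ε : ℝ, 0 < ε → ε ≤ ε₀ →
      F '' region (fun z => ψ (-z⁻¹)) ε α θ ⊆ region (fun z => ψ (-z⁻¹)) ε α θ ∧
      ∀ p ∈ region (fun z => ψ (-z⁻¹)) ε α θ,
        (∀ θ' : ℝ, 0 < θ' → θ' < Real.pi / 2 →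
          ∀ᶠ n : ℕ in atTop, F^[n] p ∈ region (fun z => ψ (-z⁻¹)) ε α θ') ∧
        (fun n : ℕ => ‖(F^[n] p).1‖) ~[atTop] (fun n : ℕ => 1 / (n : ℝ)) ∧
        (fun n : ℕ => ‖(F^[n] p).2‖) ~[atTop] (fun n : ℕ => 1 / Real.log (n : ℝ)) ∧
        AttractedAlong F (0, 1) p := by
  have hR := h.R_pos
  have hpi := Real.pi_pos
  obtain ⟨ht0, ht1⟩ := tan_le_one_of_le hα0 hα
  have hθ2 : θ < Real.pi / 2 := by linarith
  have hα2 : α < Real.pi / 2 := by linarith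
  have hθ0 : 0 < θ := hα0.trans hαθ
  have hts : Real.tan α < Real.tan θ :=
    Real.tan_lt_tan_of_lt_of_lt_pi_div_two (by linarith) hθ2 hαθ
  obtain ⟨c, N₀, hN₀, hstep⟩ := hψ.exists_chartStep h ht0 ht1.le hts
    (tan_mul_tan_lt_one hα0 hθ0 (by linarith))
  have hN₀p : 0 < N₀ := by linarith
  refine ⟨1 / N₀, by positivity, fun ε hε hεN => ?_⟩
  have hN : N₀ ≤ 1 / ε := by
    rw [le_div_iff₀ hN₀p] at hεN
    rw [le_div_iff₀ hε]
    linarith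
  have hcoord : ∀ p ∈ region (fun z => ψ (-z⁻¹)) ε α θ,
      ∃ q ∈ chart (Real.tan α) (Real.tan θ) (1 / ε), param ψ q = p := by
    intro p hp
    refine ⟨_, ?_, param_coordinates ψ p⟩
    rw [← param_mem_region_iff (ψ := ψ) hε hα0 hα2 hθ0 hθ2, param_coordinates]
    exact hp
  constructor
  · rintro _ ⟨p, hp, rfl⟩
    obtain ⟨q, hq, rfl⟩ := hcoord p hp
    obtain ⟨q', hq', hs⟩ := hstep _ hN q hq
    rw [hs.map_eq]
    exact (param_mem_region_iff hε hα0 hα2 hθ0 hθ2 q').2 hq'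
  · intro p hp
    obtain ⟨q, hq, rfl⟩ := hcoord p hp
    obtain ⟨Q, hQ, hF, hu, hv⟩ := exists_orbit (ht0.trans hts) (by positivity)
      (hstep _ hN) hq
    refine ⟨fun θ' h0 h1 => ?_, hψ.asymptotics h ht0 ht1.le (hN₀.trans hN) hQ hF hu hv⟩
    -- v_n/log n → 1 forces arg v_n → 0, so every opening θ' is eventually met; the other conditions
    -- hold along the whole orbit.
    filter_upwards [eventually_abs_im_lt (Real.tan_pos_of_pos_of_lt_pi_div_two h0 h1) hv] with n hn
    rw [hF, param_mem_region_iff hε hα0 hα2 h0 h1]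
    exact ⟨(hQ n).1, hn, (hQ n).2.2⟩

theorem region_mono {γ : ℂ → ℂ} {ε α θ θ' : ℝ} (h : θ ≤ θ') :
    region γ ε α θ ⊆ region γ ε α θ' :=
  fun _ hp => ⟨hp.1, ⟨hp.2.1.1, hp.2.1.2.1, hp.2.1.2.2.trans_le h⟩, hp.2.2⟩

end TangentId

/-! ### Assembly of the theorem -/

theorem mainTheorem3 (F : ℂ × ℂ → ℂ × ℂ)
    (hF : TangentId.IsAutomorphism F) (hid : TangentId.IsTangentToId F)
    (hform : TangentId.HasSpecialForm F) :
    TangentId.IsDegenerateDirection F (0, 1) ∧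
    ∃ r : ℝ, 0 < r ∧ ∃ γ : ℂ → ℂ,
      (∀ ε : ℝ, 0 < ε → ε ≤ r → TangentId.IsParabolicGraph F γ ε) ∧
      ∀ α θ : ℝ, 0 < α → α ≤ Real.pi / 8 → α ≤ θ → θ < 3 * Real.pi / 8 →
        ∃ ε₀ : ℝ, 0 < ε₀ ∧ ε₀ ≤ r ∧ ∀ ε : ℝ, 0 < ε → ε ≤ ε₀ →
          IsOpen (TangentId.region γ ε α θ) ∧
          IsConnected (TangentId.region γ ε α θ) ∧
          (α < θ → F '' TangentId.region γ ε α θ ⊆ TangentId.region γ ε α θ) ∧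
          ∀ p ∈ TangentId.region γ ε α θ,
            (∀ᶠ n : ℕ in atTop, F^[n] p ∈ TangentId.region γ ε α θ) ∧
            (fun n : ℕ => ‖(F^[n] p).1‖) ~[atTop] (fun n : ℕ => 1 / (n : ℝ)) ∧
            (fun n : ℕ => ‖(F^[n] p).2‖) ~[atTop] (fun n : ℕ => 1 / Real.log (n : ℝ)) ∧
            TangentId.AttractedAlong F (0, 1) p := by
  have hd : Differentiable ℂ F := hF.1
  obtain ⟨K, R, h⟩ := hform.exists_hasBounds
  obtain ⟨ψ, hψ⟩ := h.exists_isInvariantCurve hd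
  have hR := h.R_pos
  have hpi := Real.pi_pos
  have hcurve : ∀ ε : ℝ, 0 < ε → ε ≤ 1 / (8 * R) →
      TangentId.IsParabolicGraph F (fun z => ψ (-z⁻¹)) ε := fun ε _ hε => hψ.isParabolicGraph h hε
  refine ⟨TangentId.isDegenerateDirection_zero_one hd hform, 1 / (8 * R), by positivity,
    fun z => ψ (-z⁻¹), hcurve, fun α θ hα0 hα hαθ hθ => ?_⟩
  have hθ0 : 0 < θ := hα0.trans_le hαθ
  -- The midpoint of θ and 3π/8 exceeds α even when α = θ. The asymptotics are proved in this larger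
  -- region, and its orbits eventually return to the opening θ.
  obtain ⟨ε₁, hε₁, h1⟩ := hψ.exists_region_dynamics h (θ := (θ + 3 * Real.pi / 8) / 2) hα0 hα
    (by linarith) (by linarith)
  obtain ⟨ε₂, hε₂, h2⟩ : ∃ ε₂ : ℝ, 0 < ε₂ ∧ ∀ ε : ℝ, 0 < ε → ε ≤ ε₂ → α < θ →
      F '' TangentId.region (fun z => ψ (-z⁻¹)) ε α θ ⊆
        TangentId.region (fun z => ψ (-z⁻¹)) ε α θ := by
    by_cases hlt : α < θ
    · obtain ⟨ε₂, hε₂, h2⟩ := hψ.exists_region_dynamics h hα0 hα hlt hθ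
      exact ⟨ε₂, hε₂, fun ε h0 hε _ => (h2 ε h0 hε).1⟩
    · exact ⟨1, one_pos, fun _ _ _ hlt' => absurd hlt' hlt⟩
  refine ⟨min (1 / (8 * R)) (min ε₁ ε₂), by positivity, min_le_left _ _, fun ε hε hεm => ?_⟩
  have hεr : ε ≤ 1 / (8 * R) := hεm.trans (min_le_left _ _)
  have hεε₁ : ε ≤ ε₁ := hεm.trans ((min_le_right _ _).trans (min_le_left _ _))
  have hεε₂ : ε ≤ ε₂ := hεm.trans ((min_le_right _ _).trans (min_le_right _ _))
  have hγ : ContinuousOn (fun z => ψ (-z⁻¹)) (TangentId.sector ε α) :=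
    (hcurve ε hε hεr).analytic.continuousOn.mono
      fun z hz => ⟨hz.1, hz.2.1, hz.2.2.trans_le hα⟩
  refine ⟨TangentId.isOpen_region hα0 (by linarith) hθ0 (by linarith) hγ,
    TangentId.isConnected_region hε hα0 (by linarith) hθ0 (by linarith) hγ, h2 ε hε hεε₂,
    fun p hp => ?_⟩
  obtain ⟨h3, h4⟩ := (h1 ε hε hεε₁).2 p (TangentId.region_mono (by linarith) hp)
  exact ⟨h3 θ hθ0 (by linarith), h4⟩
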